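/- **Setting.** A metrical task system (MTS) consists of a metric space $(M,d)$ of finite diameter $D=\sup_{s,s'\in M}d(s,s')$, a starting point $s_0\in M$, and cost functions $c_1,\dots,c_T\colon M\to[0,+\infty]$; at time $t$ an algorithm sees $c_t$, moves from $s_{t-1}$ to a state $s_t$ and pays $c_t(s_t)+d(s_{t-1},s_t)$. There are $\ell\ge 2$ heuristics $H_1,\dots,H_\ell$; $H_i$ is in state $s^i_t$ at time $t$, and $s^i_0=s_0$. The cost functions and the states of the heuristics are fixed in advance (oblivious adversary). The cost of $H_i$ at time $t$ is $f_t(i)=c_t(s^i_t)+d(s^i_{t-1},s^i_t)$, it is assumed that $f_t(i)\in[0,2D]$, and $\mathrm{OPT}_{\le 0}=\min_{i}\sum_{t=1}^T f_t(i)$. For $m\ge 2$, $m$-delayed bandit access means that one heuristic may be queried at each time $t\geq 1$, and that the answer to a query of $H_i$ at time $t$ is $s^i_t$ if $H_i$ was queried in all the steps $t-m+2,\dots,t$, and is empty otherwise. **Algorithm**, with parameters $\epsilon,\eta$. Let $\beta_0=0$, let $\beta_1,\beta_2,\dots\sim\mathrm{Bernoulli}(\epsilon)$ and $e_1,e_2,\dots\sim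 U(\{1,\dots,\ell\})$ be independent. Time $0$ is an exploitation step. If $t$ is an exploitation step with $\beta_t=0$, then $t+1$ is an exploitation step; if $\beta_t=1$, then $H_{e_{t+m}}$ is queried in steps $t+1,\dots,t+m$, step $t+m$ is an exploration step, and $t+m+1$ is an exploitation step. In an exploration step $t$ set $g_t(e_t)=f_t(e_t)/(2D)$, computed from the answers at times $t-1$ and $t$, and $g_t(i)=0$ for $i\ne e_t$; in all other steps $g_t=0$. The distribution $x_t$ over the heuristics is that of HEDGE with learning rate $\eta$: $x_t(i)=w_t(i)/\sum_j w_t(j)$ with $w_0=1$, $w_{t+1}(i)=w_t(i)e^{-\eta g_t(i)}$. The exploited heuristic $i_0$ is uniform; $i_t=i_{t-1}$ if $x_t=x_{t-1}$, and otherwise $i_t=j$ with probability $\tau_{i_{t-1},j}/x_{t-1}(i_{t-1})$, where $\tau\ge 0$ is any transport plan from $x_{t-1}$ to $x_t$ with $\sum_{i\ne j}\tau_{i,j}=\sum_i\max(0,x_{t-1}(i)-x_t(i))$. In exploitation steps $H_{i_t}$ is queried. If $s^{i_t}_t$ is known from the answer at time $t$, the algorithm goes to $s_t=b_t=s_t^{i_t}$;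 otherwise $b_t=b_{t-1}$ and $s_t\in\arg\min_{s}(d(b_t,s)+c_t(s))$ (a minimizer is assumed to exist; ties are broken by any rule), where $b_0=s_0$. The parameters are $$\epsilon=(D\ell\ln\ell)^{1/3}m^{-4/3}\mathrm{OPT}_{\le 0}^{-1/3},\qquad \gamma=(D\ell\ln\ell)^{1/3}m^{2/3}\mathrm{OPT}_{\le 0}^{-1/3},\qquad \eta=-\ln(1-\gamma).$$ **Theorem.** Let $D$ be bounded away from $0$ and $D\ell m= o(\mathrm{OPT}_{\le 0}^{1/3})$. Then the expected cost of this algorithm satisfies $$\mathbb E[\mathrm{ALG}]\le \mathrm{OPT}_{\le 0}+O\big((D\ell\ln\ell)^{1/3}m^{2/3}\,\mathrm{OPT}_{\le 0}^{2/3}\big).$$ Precisely: there is an absolute constant $C>0$ such that for every $D_0>0$ there is $\kappa>0$ such that for all $\ell,m\ge 2$ and all instances as above with $D\ge D_0$ and $D\ell m\le\kappa\,\mathrm{OPT}_{\le 0}^{1/3}$, we have $0<\epsilon<1$, $0<\gamma<1$, and $\mathbb E[\mathrm{ALG}]\le\mathrm{OPT}_{\le 0}+C\,(D\ell\ln\ell)^{1/3}m^{2/3}\,\mathrm{OPT}_{\le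 0}^{2/3}$. -/

import Mathlib

open scoped ENNReal

noncomputable section

namespace BanditMTS

/-- An input of a metrical task system with `ℓ` heuristics, fixed in advance by an oblivious
adversary: horizon `T`, starting point `s₀`, cost functions `c 1, …, c T` with values in
`[0, ∞]`, and the state `H i t` of the heuristic `i` at time `t`. All heuristics start in `s₀`. -/
structure Instance (M : Type*) (ℓ : ℕ) where
  T : ℕ
  s₀ : M
  c : ℕ → M → ℝ≥0∞
  H : Fin ℓ → ℕ → M
  H_zero : ∀ i, H i 0 = s₀

/-- The cost `f_t(i) = c_t(s_t^i) + d(s_{t-1}^i, s_t^i)` paid by the heuristic `i` at time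
`t ≥ 1`. -/
def Instance.f {M : Type*} [MetricSpace M] {ℓ : ℕ} (I : Instance M ℓ) (t : ℕ) (i : Fin ℓ) :
    ℝ≥0∞ :=
  I.c t (I.H i t) + edist (I.H i (t - 1)) (I.H i t)

/-- `OPT_{≤ 0}`, the total cost of the best single heuristic. -/
def Instance.opt {M : Type*} [MetricSpace M] {ℓ : ℕ} (I : Instance M ℓ) : ℝ≥0∞ :=
  ⨅ i : Fin ℓ, ∑ t ∈ Finset.Icc 1 I.T, I.f t i

/-- `m`-delayed bandit access. Exactly one heuristic `q t` is queried at each time `t ≥ 1`. The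
answer at time `t` is the current state of `q t` if `q t` was queried in all the steps
`t - m + 2, …, t` (which must be steps `≥ 1`), and it is empty otherwise. -/
def answer {M : Type*} {ℓ : ℕ} (m : ℕ) (H : Fin ℓ → ℕ → M) (q : ℕ → Fin ℓ) (t : ℕ) : Option M :=
  open Classical in
  if m ≤ t + 1 ∧ ∀ u ≤ t, t + 2 ≤ u + m → q u = q t then some (H (q t) t) else none

/-! ### The learning dynamics

The algorithm uses the heuristics only through the stream `a : ℕ → Option M` of answers. -/

/-- `timer m β t` is `0` if `t` is an exploitation step. If `u` is an exploitation step with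
`β u = true`, the steps `u + 1, …, u + m` have timers `m, m - 1, …, 1`; the last of them, the one
with timer `1`, is the exploration step, and `u + m + 1` is an exploitation step again. -/
def timer (m : ℕ) (β : ℕ → Bool) : ℕ → ℕ
  | 0 => 0
  | t + 1 => if timer m β t = 0 then (if β t then m else 0) else timer m β t - 1

/-- The queried heuristic: the exploited heuristic `i t` in an exploitation step, and otherwise
the heuristic `e u`, where `u = t + timer t - 1` is the upcoming (or present) exploration step. -/
def query {ℓ : ℕ} (m : ℕ) (β : ℕ → Bool) (e i : ℕ → Fin ℓ) (t : ℕ) : Fin ℓ :=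
  if timer m β t = 0 then i t else e (t + timer m β t - 1)

/-- The loss vector `g_t` fed to the full-feedback learner. In an exploration step, the coordinate
of the explored heuristic is its observed cost divided by `2 D`, computed from its states at times
`t - 1` and `t`; everything else is zero. -/
def loss {M : Type*} [MetricSpace M] {ℓ : ℕ} (D : ℝ) (c : ℕ → M → ℝ≥0∞) (r : ℕ → ℕ)
    (q : ℕ → Fin ℓ) (a : ℕ → Option M) (t : ℕ) (j : Fin ℓ) : ℝ :=
  if r t = 1 ∧ j = q t then
    match a (t - 1), a t with
    | some y', some y => (c t y + edist y' y).toReal / (2 * D)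
    | _, _ => 0
  else 0

/-- The weights of HEDGE with learning rate `η` for the loss vectors `g 0, g 1, …`. -/
def hedgeWeight {ℓ : ℕ} (η : ℝ) (g : ℕ → Fin ℓ → ℝ) : ℕ → Fin ℓ → ℝ
  | 0 => fun _ => 1
  | t + 1 => fun j => hedgeWeight η g t j * Real.exp (-η * g t j)

/-- The distribution `x_t` over the heuristics chosen by HEDGE after seeing the losses
`g 0, …, g (t - 1)`. It does not change after a step with `g = 0`. -/
def hedge {ℓ : ℕ} (η : ℝ) (g : ℕ → Fin ℓ → ℝ) (t : ℕ) (j : Fin ℓ) : ℝ :=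
  hedgeWeight η g t j / ∑ k, hedgeWeight η g t k

/-! ### Producing a solution -/

/-- The procedure Round: `R p p' i` is the law of the new index if the old index is `i`. It moves
from `i` to `j` with probability `τ i j / p i`, where `τ` is an optimal way of transferring the
mass of the distribution `p` to `p'`, i.e. the mass moved is `∑ i, max 0 (p i - p' i)`. -/
def IsRound {ℓ : ℕ} (R : (Fin ℓ → ℝ) → (Fin ℓ → ℝ) → Fin ℓ → PMF (Fin ℓ)) : Prop :=
  ∀ p ∈ stdSimplex ℝ (Fin ℓ), ∀ p' ∈ stdSimplex ℝ (Fin ℓ), ∃ τ : Fin ℓ → Fin ℓ → ℝ,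
    (∀ i j, 0 ≤ τ i j) ∧ (∀ i, ∑ j, τ i j = p i) ∧ (∀ j, ∑ i, τ i j = p' j) ∧
    ∑ i, ∑ j ∈ Finset.univ.erase i, τ i j = ∑ i, max 0 (p i - p' i) ∧
    ∀ i, p i ≠ 0 → ∀ j, R p p' i j = ENNReal.ofReal (τ i j / p i)

/-- `greedy t b` is a point of `argmin_s (d(b, s) + c_t(s))`, for any way of breaking ties. -/
def IsGreedy {M : Type*} [MetricSpace M] {ℓ : ℕ} (I : Instance M ℓ) (greedy : ℕ → M → M) : Prop :=
  ∀ t ∈ Finset.Icc 1 I.T, ∀ b s : M,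
    edist b (greedy t b) + I.c t (greedy t b) ≤ edist b s + I.c t s

/-- The state of the exploited heuristic `i t` at time `t`, if it is known. -/
def known {M : Type*} {ℓ : ℕ} (q i : ℕ → Fin ℓ) (a : ℕ → Option M) (t : ℕ) : Option M :=
  if q t = i t then a t else none

/-- The last known state `b_t` of an exploited heuristic. -/
def lastKnown {M : Type*} {ℓ : ℕ} (s₀ : M) (q i : ℕ → Fin ℓ) (a : ℕ → Option M) : ℕ → M
  | 0 => s₀
  | t + 1 => (known q i a (t + 1)).getD (lastKnown s₀ q i a t)

/-- The state `s_t` of the algorithm: the state of the exploited heuristic if it is known, and a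
greedy step from `b_t` otherwise. -/
def position {M : Type*} {ℓ : ℕ} (s₀ : M) (greedy : ℕ → M → M) (q i : ℕ → Fin ℓ)
    (a : ℕ → Option M) : ℕ → M
  | 0 => s₀
  | t + 1 => (known q i a (t + 1)).getD (greedy (t + 1) (lastKnown s₀ q i a (t + 1)))

/-! ### The random choices

A realization consists of the coins `β`, the explored heuristics `e` and the exploited heuristics
`i`. Given these three sequences, the run of the algorithm is determined. -/

/-- The answers received by the algorithm. -/
def Instance.answers {M : Type*} {ℓ : ℕ} (I : Instance M ℓ) (m : ℕ) (β : ℕ → Bool)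
    (e i : ℕ → Fin ℓ) : ℕ → Option M :=
  answer m I.H (query m β e i)

/-- The distributions `x_0, x_1, …` over the heuristics. -/
def Instance.dist {M : Type*} [MetricSpace M] {ℓ : ℕ} (I : Instance M ℓ) (D : ℝ) (m : ℕ) (η : ℝ)
    (β : ℕ → Bool) (e i : ℕ → Fin ℓ) : ℕ → Fin ℓ → ℝ :=
  hedge η (loss D I.c (timer m β) (query m β e i) (I.answers m β e i))

/-- The cost of the algorithm. -/
def Instance.cost {M : Type*} [MetricSpace M] {ℓ : ℕ} (I : Instance M ℓ) (greedy : ℕ → M → M)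
    (m : ℕ) (β : ℕ → Bool) (e i : ℕ → Fin ℓ) : ℝ≥0∞ :=
  let s := position I.s₀ greedy (query m β e i) i (I.answers m β e i)
  ∑ t ∈ Finset.Icc 1 I.T, (I.c t (s t) + edist (s (t - 1)) (s t))

/-- The probability of the coins: `β 0 = 0`, and `β 1, …, β T` are independent with
`P(β t = 1) = ε`. -/
def coinProb (T : ℕ) (ε : ℝ) (β : ℕ → Bool) : ℝ≥0∞ :=
  if β 0 then 0 else
    ∏ t ∈ Finset.Icc 1 T, if β t then ENNReal.ofReal ε else ENNReal.ofReal (1 - ε)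

/-- The conditional probability of `i 0, …, i T` given `β` and `e`: `i 0` is uniform, and `i t` is
drawn by `Round(i (t - 1), x (t - 1), x t)` if `x t ≠ x (t - 1)` and equal to `i (t - 1)`
otherwise. -/
def pathProb {ℓ : ℕ} (R : (Fin ℓ → ℝ) → (Fin ℓ → ℝ) → Fin ℓ → PMF (Fin ℓ)) (T : ℕ)
    (x : ℕ → Fin ℓ → ℝ) (i : ℕ → Fin ℓ) : ℝ≥0∞ :=
  open Classical in
  (ℓ : ℝ≥0∞)⁻¹ * ∏ t ∈ Finset.Icc 1 T,
    if x t ≠ x (t - 1) then R (x (t - 1)) (x t) (i (t - 1)) (i t)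
    else if i t = i (t - 1) then 1 else 0

/-- Extension of a finite sequence to `ℕ`; only the values at `0, …, n` are relevant. -/
def ext {α : Type*} {n : ℕ} (u : Fin (n + 1) → α) (t : ℕ) : α := u (Fin.ofNat (n + 1) t)

/-- The expected cost of the algorithm with exploration rate `ε` and HEDGE with learning rate `η`.
The sequence `e` is uniform and independent of `β`. It has `T + m` terms (and a dummy term `e 0`)
since an exploration block can begin before time `T` and end after it. -/
def Instance.expectedCost {M : Type*} [MetricSpace M] {ℓ : ℕ} (I : Instance M ℓ)
    (greedy : ℕ → M → M) (R : (Fin ℓ → ℝ) → (Fin ℓ → ℝ) → Fin ℓ → PMF (Fin ℓ))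
    (D : ℝ) (m : ℕ) (ε η : ℝ) : ℝ≥0∞ :=
  ∑ β : Fin (I.T + 1) → Bool, ∑ e : Fin (I.T + m + 1) → Fin ℓ, ∑ i : Fin (I.T + 1) → Fin ℓ,
    coinProb I.T ε (ext β) * ((ℓ : ℝ≥0∞)⁻¹) ^ (I.T + m + 1) *
      pathProb R I.T (I.dist D m η (ext β) (ext e) (ext i)) (ext i) *
      I.cost greedy m (ext β) (ext e) (ext i)

/-- The exploration rate `ε = (D ℓ ln ℓ)^{1/3} m^{-4/3} OPT^{-1/3}`. -/
def epsParam (D : ℝ) (ℓ m : ℕ) (opt : ℝ) : ℝ :=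
  (D * ℓ * Real.log ℓ) ^ (1 / 3 : ℝ) * (m : ℝ) ^ (-4 / 3 : ℝ) * opt ^ (-1 / 3 : ℝ)

/-- `γ = (D ℓ ln ℓ)^{1/3} m^{2/3} OPT^{-1/3}`. -/
def gammaParam (D : ℝ) (ℓ m : ℕ) (opt : ℝ) : ℝ :=
  (D * ℓ * Real.log ℓ) ^ (1 / 3 : ℝ) * (m : ℝ) ^ (2 / 3 : ℝ) * opt ^ (-1 / 3 : ℝ)

/-- The learning rate `η` of HEDGE, given by `γ = 1 - exp (-η)`. -/
def etaParam (D : ℝ) (ℓ m : ℕ) (opt : ℝ) : ℝ := -Real.log (1 - gammaParam D ℓ m opt)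

end BanditMTS

end

/-!
The losses shown to HEDGE do not depend on the exploited heuristics, so the distributions `x_t` are
functions of the coins and the explored heuristics only. Conditionally on these, `i_t` has law
`x_t`, and it changes with probability equal to the moved mass of the update. The state of `i_t` can
be unknown only within `m` steps of an exploration block; during such a run of stale steps, the
greedy choice costs at most what following `i_t` costs plus twice the backlog, that is, the cost
which following the exploited heuristics has accumulated in the run.

Exploration steps are more than `m` apart and each of them changes the weights by a factor at least
`exp (-η) = 1 - γ`. Hence the mean costs `∑ j, x_s(j) f_t(j)` at nearby times `s` are comparable and
almost independent of the coins tossed in between. Consequently the expected cost is, up to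
lower-order terms, at most `(1 + O(γ)) * 2Dℓ / ε` times the expected loss of HEDGE, which is
controlled by its regret bound, and the backlog is `O(m² ε)` times the expected cost. With
`γ = m² ε` and `D ℓ log ℓ = ε γ² OPT`, every error term is `O(γ OPT)`.
-/

noncomputable section

namespace BanditMTS

/-! ### Exploration blocks -/

section timer

variable {m : ℕ} {β β' : ℕ → Bool} {s t : ℕ}

theorem timer_congr (h : ∀ u < t, β u = β' u) : timer m β t = timer m β' t := by
  induction t with
  | zero => rfl
  | succ t ih => rw [timer, timer, ih fun u hu => h u (by omega), h t (by omega)]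

theorem exists_start_of_timer_ne_zero (h : timer m β t ≠ 0) :
    ∃ s < t, t + timer m β t = s + m + 1 ∧ timer m β s = 0 ∧ β s = true := by
  induction t with
  | zero => exact absurd rfl h
  | succ t ih =>
    by_cases h0 : timer m β t = 0
    · have hβ : β t = true := by
        by_contra hβ
        simp [timer, h0, hβ] at h
      have ht : timer m β (t + 1) = m := by rw [timer, if_pos h0, if_pos hβ]
      exact ⟨t, by omega, by omega, h0, hβ⟩
    · obtain ⟨s, hs, heq, hs0, hβ⟩ := ih h0
      rw [timer, if_neg h0] at h ⊢
      exact ⟨s, by omega, by omega, hs0, hβ⟩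

theorem timer_start_add (h0 : timer m β s = 0) (hβ : β s = true) {k : ℕ} (hk : k < m) :
    timer m β (s + k + 1) = m - k := by
  induction k with
  | zero => rw [timer, if_pos h0, if_pos hβ, Nat.sub_zero]
  | succ k ih =>
    have := ih (by omega)
    rw [← add_assoc, timer, this, if_neg (by omega)]
    omega

theorem timer_add_eq_one_iff (hm : 1 ≤ m) :
    timer m β (s + m) = 1 ↔ timer m β s = 0 ∧ β s = true := by
  constructor
  · intro h
    obtain ⟨u, -, heq, hu⟩ := exists_start_of_timer_ne_zero (h.trans_ne one_ne_zero)
    obtain rfl : u = s := by omega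
    exact hu
  · rintro ⟨h0, hβ⟩
    have := timer_start_add h0 hβ (k := m - 1) (by omega)
    rw [show s + (m - 1) + 1 = s + m by omega] at this
    omega

theorem exists_coin_of_timer_ne_zero (h : timer m β t ≠ 0) :
    ∃ s ∈ Finset.Ico (t - m) t, β s = true := by
  obtain ⟨s, hst, heq, -, hβ⟩ := exists_start_of_timer_ne_zero h
  exact ⟨s, Finset.mem_Ico.2 ⟨by omega, hst⟩, hβ⟩

theorem le_of_timer_eq_one (h : timer m β t = 1) : m ≤ t := by
  obtain ⟨s, -, heq, -⟩ := exists_start_of_timer_ne_zero (h.trans_ne one_ne_zero)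
  omega

theorem timer_sub_of_timer_eq_one (h : timer m β t = 1) {k : ℕ} (hk : k < m) :
    timer m β (t - k) = k + 1 := by
  obtain ⟨s, -, heq, h0, hβ⟩ := exists_start_of_timer_ne_zero (h.trans_ne one_ne_zero)
  have := timer_start_add h0 hβ (k := m - 1 - k) (by omega)
  rw [show s + (m - 1 - k) + 1 = t - k by omega] at this
  omega

theorem add_lt_of_timer_eq_one (hs : timer m β s = 1) (ht : timer m β t = 1) (hst : s < t) :
    s + m < t := by
  by_contra hlt
  obtain ⟨u, -, heq, h0, hβ⟩ := exists_start_of_timer_ne_zero (ht.trans_ne one_ne_zero)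
  have hus : u ≠ s := fun h => by
    rw [h, hs] at h0
    exact one_ne_zero h0
  have := timer_start_add h0 hβ (k := s - u - 1) (by omega)
  rw [show u + (s - u - 1) + 1 = s by omega] at this
  omega

theorem card_filter_timer_eq_one_le_one (hst : t ≤ s + m + 1) :
    ((Finset.Ico s t).filter fun u => timer m β u = 1).card ≤ 1 := by
  rw [Finset.card_le_one]
  intro a ha b hb
  rw [Finset.mem_filter, Finset.mem_Ico] at ha hb
  rcases lt_trichotomy a b with h | h | h
  · have := add_lt_of_timer_eq_one ha.2 hb.2 h
    omega
  · exact h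
  · have := add_lt_of_timer_eq_one hb.2 ha.2 h
    omega

end timer

/-! ### Stale steps and the backlog -/

section backlog

variable {m : ℕ} {β β' : ℕ → Bool} {F F' : ℕ → ℝ} {s t : ℕ}

/-- A step at which the answer for a queried exploited heuristic may be empty: one of the first
`m - 2` steps, or a step such that one of the `m - 1` steps up to it lies in an exploration
block. -/
def Stale (m : ℕ) (β : ℕ → Bool) (t : ℕ) : Prop :=
  t + 1 < m ∨ ∃ u ≤ t, t + 2 ≤ u + m ∧ timer m β u ≠ 0

theorem stale_congr (h : ∀ u < t, β u = β' u) : Stale m β t ↔ Stale m β' t := by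
  refine or_congr Iff.rfl (exists_congr fun u => and_congr_right fun hu => ?_)
  rw [timer_congr fun v hv => h v (by omega)]

theorem Stale.lt_or_exists_coin (h : Stale m β t) :
    t + 1 < m ∨ ∃ s ∈ Finset.Ico (t - 2 * m) t, β s = true := by
  refine h.imp_right fun ⟨u, hu, hut, hne⟩ => ?_
  obtain ⟨s, hs, hβ⟩ := exists_coin_of_timer_ne_zero hne
  rw [Finset.mem_Ico] at hs
  exact ⟨s, Finset.mem_Ico.2 ⟨by omega, by omega⟩, hβ⟩

open Classical in
/-- The amount of `F` accumulated at time `t` in the current run of consecutive stale steps. If `F`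
is the cost of following the exploited heuristic, this bounds the distance from the position of the
algorithm to the current state of that heuristic. -/
def backlog (m : ℕ) (β : ℕ → Bool) (F : ℕ → ℝ) : ℕ → ℝ
  | 0 => 0
  | t + 1 => if Stale m β (t + 1) then backlog m β F t + F (t + 1) else 0

theorem backlog_congr (h : ∀ u < t, β u = β' u) (hF : ∀ u ≤ t, F u = F' u) :
    backlog m β F t = backlog m β' F' t := by
  induction t with
  | zero => rfl
  | succ t ih =>
    rw [backlog, backlog, ih (fun u hu => h u (by omega)) fun u hu => hF u (by omega),
      hF _ le_rfl, stale_congr h]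

theorem backlog_nonneg (hF : ∀ u, 0 ≤ F u) (t : ℕ) : 0 ≤ backlog m β F t := by
  induction t with
  | zero => exact le_rfl
  | succ t ih =>
    rw [backlog]
    split_ifs
    exacts [add_nonneg ih (hF _), le_rfl]

theorem backlog_eq_zero (h : ¬ Stale m β t) : backlog m β F t = 0 := by
  cases t with
  | zero => rfl
  | succ t => rw [backlog, if_neg h]

theorem backlog_succ_le (hF : ∀ u, 0 ≤ F u) (t : ℕ) :
    backlog m β F (t + 1) ≤ backlog m β F t + F (t + 1) := by
  rw [backlog]
  split_ifs
  exacts [le_rfl, add_nonneg (backlog_nonneg hF t) (hF _)]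

theorem backlog_le_add_sum (hF : ∀ u, 0 ≤ F u) (hst : s ≤ t) :
    backlog m β F t ≤ backlog m β F s + ∑ u ∈ Finset.Ioc s t, F u := by
  induction t, hst using Nat.le_induction with
  | base => rw [Finset.Ioc_self, Finset.sum_empty, add_zero]
  | succ t hst ih =>
    rw [Finset.sum_Ioc_succ_top (by omega), ← add_assoc]
    exact (backlog_succ_le hF t).trans (add_le_add_left ih _)

theorem backlog_le_mul {K : ℝ} (hF : ∀ u, 0 ≤ F u) (hK : ∀ u, F u ≤ K) (t : ℕ) :
    backlog m β F t ≤ t * K := by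
  refine (backlog_le_add_sum hF (Nat.zero_le t)).trans ?_
  rw [backlog, zero_add]
  refine (Finset.sum_le_card_nsmul _ _ K fun u _ => hK u).trans_eq ?_
  rw [Nat.card_Ioc, Nat.sub_zero, nsmul_eq_mul]

theorem backlog_add_le {A B : ℕ → ℝ} {K : ℝ} (hA : ∀ u, 0 ≤ A u) (hB : ∀ u, 0 ≤ B u)
    (hK : ∀ u, A u + B u ≤ K) (t : ℕ) :
    backlog m β (fun u => A u + B u) t ≤ (if t < m then m * K else 0) +
      (∑ s ∈ Finset.Ico (t - 2 * m) t, (if β s then 1 else 0) *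
        (backlog m β (fun u => A u + B u) (t - 2 * m) +
          ∑ u ∈ Finset.Ioc (t - 2 * m) t, A u)) +
      ∑ u ∈ Finset.Ioc (t - 2 * m) t, B u := by
  have hF : ∀ u, 0 ≤ A u + B u := fun u => add_nonneg (hA u) (hB u)
  have hK0 : 0 ≤ K := (hF 0).trans (hK 0)
  have hinit : (0 : ℝ) ≤ if t < m then m * K else 0 := by split_ifs <;> positivity
  have hcoin : ∀ s ∈ Finset.Ico (t - 2 * m) t, (0 : ℝ) ≤ (if β s then 1 else 0) *
      (backlog m β (fun u => A u + B u) (t - 2 * m) + ∑ u ∈ Finset.Ioc (t - 2 * m) t, A u) :=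
    fun s _ => mul_nonneg (by split_ifs <;> norm_num)
      (add_nonneg (backlog_nonneg hF _) (Finset.sum_nonneg fun u _ => hA u))
  have hBsum : 0 ≤ ∑ u ∈ Finset.Ioc (t - 2 * m) t, B u := Finset.sum_nonneg fun u _ => hB u
  have hcoinsum := Finset.sum_nonneg hcoin
  by_cases hstale : Stale m β t
  · rcases hstale.lt_or_exists_coin with ht | ⟨s, hs, hβ⟩
    · have hle := backlog_le_mul (m := m) (β := β) hF hK t
      have htm : (t : ℝ) * K ≤ m * K := by gcongr; omega
      rw [if_pos (by omega)]
      linarith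
    · have hle := backlog_le_add_sum (m := m) (β := β) hF (Nat.sub_le t (2 * m))
      have hone := Finset.single_le_sum hcoin hs
      rw [if_pos hβ, one_mul] at hone
      rw [Finset.sum_add_distrib] at hle
      linarith
  · rw [backlog_eq_zero hstale]
    linarith

end backlog

/-! ### HEDGE -/

section hedge

variable {ℓ : ℕ} {η : ℝ} {g g' : ℕ → Fin ℓ → ℝ} {t : ℕ}

theorem hedgeWeight_succ (t : ℕ) (j : Fin ℓ) :
    hedgeWeight η g (t + 1) j = hedgeWeight η g t j * Real.exp (-η * g t j) := rfl

theorem hedgeWeight_pos (η : ℝ) (g : ℕ → Fin ℓ → ℝ) (t : ℕ) (j : Fin ℓ) :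
    0 < hedgeWeight η g t j := by
  induction t with
  | zero => exact one_pos
  | succ t ih => exact mul_pos ih (Real.exp_pos _)

theorem hedgeWeight_eq_exp (t : ℕ) (j : Fin ℓ) :
    hedgeWeight η g t j = Real.exp (-η * ∑ s ∈ Finset.range t, g s j) := by
  induction t with
  | zero => rw [Finset.sum_range_zero, mul_zero, Real.exp_zero, hedgeWeight]
  | succ t ih => rw [hedgeWeight_succ, ih, Finset.sum_range_succ, mul_add, Real.exp_add]

theorem hedge_congr (h : ∀ u < t, g u = g' u) : hedge η g t = hedge η g' t := by
  ext j
  simp only [hedge, hedgeWeight_eq_exp, Finset.sum_congr rfl fun u hu =>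
    congrFun (h u (Finset.mem_range.1 hu)) _]

theorem hedgeWeight_succ_le (hη : 0 ≤ η) (hg : ∀ j, 0 ≤ g t j) (j : Fin ℓ) :
    hedgeWeight η g (t + 1) j ≤ hedgeWeight η g t j := by
  refine mul_le_of_le_one_right (hedgeWeight_pos η g t j).le (Real.exp_le_one_iff.2 ?_)
  rw [neg_mul]
  exact neg_nonpos.2 (mul_nonneg hη (hg j))

theorem exp_neg_mul_hedgeWeight_le_succ (hη : 0 ≤ η) (hg1 : ∀ j, g t j ≤ 1) (j : Fin ℓ) :
    Real.exp (-η) * hedgeWeight η g t j ≤ hedgeWeight η g (t + 1) j := by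
  rw [hedgeWeight_succ, mul_comm, neg_mul]
  gcongr
  · exact (hedgeWeight_pos η g t j).le
  · exact mul_le_of_le_one_right hη (hg1 j)

theorem hedge_zero (η : ℝ) (g : ℕ → Fin ℓ → ℝ) (j : Fin ℓ) : hedge η g 0 j = (ℓ : ℝ)⁻¹ := by
  simp [hedge, hedgeWeight]

theorem hedge_succ_of_eq_zero (h : ∀ j, g t j = 0) : hedge η g (t + 1) = hedge η g t := by
  ext j
  simp only [hedge, hedgeWeight_succ, h, mul_zero, Real.exp_zero, mul_one]

variable [NeZero ℓ]

theorem sum_hedgeWeight_pos (η : ℝ) (g : ℕ → Fin ℓ → ℝ) (t : ℕ) :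
    0 < ∑ k, hedgeWeight η g t k :=
  Finset.sum_pos (fun k _ => hedgeWeight_pos η g t k) Finset.univ_nonempty

theorem hedge_pos (η : ℝ) (g : ℕ → Fin ℓ → ℝ) (t : ℕ) (j : Fin ℓ) : 0 < hedge η g t j :=
  div_pos (hedgeWeight_pos η g t j) (sum_hedgeWeight_pos η g t)

theorem sum_hedge (η : ℝ) (g : ℕ → Fin ℓ → ℝ) (t : ℕ) : ∑ j, hedge η g t j = 1 := by
  simp only [hedge]
  rw [← Finset.sum_div, div_self (sum_hedgeWeight_pos η g t).ne']

theorem hedge_mem_stdSimplex (η : ℝ) (g : ℕ → Fin ℓ → ℝ) (t : ℕ) :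
    hedge η g t ∈ stdSimplex ℝ (Fin ℓ) :=
  ⟨fun j => (hedge_pos η g t j).le, sum_hedge η g t⟩

theorem sum_hedgeWeight_mul (a : Fin ℓ → ℝ) :
    ∑ j, hedgeWeight η g t j * a j = (∑ k, hedgeWeight η g t k) * ∑ j, hedge η g t j * a j := by
  rw [Finset.mul_sum]
  refine Finset.sum_congr rfl fun j _ => ?_
  rw [← mul_assoc, hedge, mul_div_cancel₀ _ (sum_hedgeWeight_pos η g t).ne']

theorem hedge_mul_exp_le_succ (hη : 0 ≤ η) (hg : ∀ j, 0 ≤ g t j) (j : Fin ℓ) :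
    hedge η g t j * Real.exp (-η * g t j) ≤ hedge η g (t + 1) j := by
  rw [hedge, hedge, div_mul_eq_mul_div, ← hedgeWeight_succ]
  exact div_le_div_of_nonneg_left (hedgeWeight_pos η g _ j).le (sum_hedgeWeight_pos η g _)
    (Finset.sum_le_sum fun k _ => hedgeWeight_succ_le hη hg k)

theorem exp_neg_mul_hedge_le_succ (hη : 0 ≤ η) (hg : ∀ j, 0 ≤ g t j) (hg1 : ∀ j, g t j ≤ 1)
    (j : Fin ℓ) : Real.exp (-η) * hedge η g t j ≤ hedge η g (t + 1) j := by
  refine le_trans ?_ (hedge_mul_exp_le_succ hη hg j)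
  rw [mul_comm, neg_mul]
  gcongr
  · exact (hedge_pos η g t j).le
  · exact mul_le_of_le_one_right hη (hg1 j)

theorem exp_neg_mul_hedge_succ_le (hη : 0 ≤ η) (hg : ∀ j, 0 ≤ g t j) (hg1 : ∀ j, g t j ≤ 1)
    (j : Fin ℓ) : Real.exp (-η) * hedge η g (t + 1) j ≤ hedge η g t j := by
  have hsum : Real.exp (-η) * ∑ k, hedgeWeight η g t k ≤ ∑ k, hedgeWeight η g (t + 1) k := by
    rw [Finset.mul_sum]
    exact Finset.sum_le_sum fun k _ => exp_neg_mul_hedgeWeight_le_succ hη hg1 k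
  rw [hedge, hedge, ← mul_div_assoc, div_le_div_iff₀ (sum_hedgeWeight_pos η g _)
    (sum_hedgeWeight_pos η g _), mul_right_comm, mul_comm]
  exact mul_le_mul (hedgeWeight_succ_le hη hg j) hsum
    (mul_nonneg (Real.exp_pos _).le (sum_hedgeWeight_pos η g _).le) (hedgeWeight_pos η g _ _).le

theorem sum_max_hedge_sub_succ_le (hη : 0 ≤ η) (hg : ∀ j, 0 ≤ g t j) :
    ∑ j, max 0 (hedge η g t j - hedge η g (t + 1) j) ≤ η * ∑ j, hedge η g t j * g t j := by
  rw [Finset.mul_sum]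
  refine Finset.sum_le_sum fun j _ => max_le ?_ ?_
  · exact mul_nonneg hη (mul_nonneg (hedge_pos η g t j).le (hg j))
  · have hsucc := hedge_mul_exp_le_succ hη hg j
    have hexp := mul_le_mul_of_nonneg_left (Real.add_one_le_exp (-η * g t j))
      (hedge_pos η g t j).le
    linarith

theorem exp_neg_mul_le (η : ℝ) {y : ℝ} (h0 : 0 ≤ y) (h1 : y ≤ 1) :
    Real.exp (-η * y) ≤ 1 - (1 - Real.exp (-η)) * y := by
  have hconv := convexOn_exp.2 (Set.mem_univ (-η)) (Set.mem_univ 0) h0 (sub_nonneg.2 h1)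
    (add_sub_cancel _ _)
  simp only [smul_eq_mul, mul_zero, add_zero, Real.exp_zero, mul_one] at hconv
  rw [mul_comm] at hconv
  linarith

theorem sum_hedgeWeight_succ_le (hg : ∀ j, 0 ≤ g t j) (hg1 : ∀ j, g t j ≤ 1) :
    ∑ k, hedgeWeight η g (t + 1) k ≤ (∑ k, hedgeWeight η g t k) *
      Real.exp (-(1 - Real.exp (-η)) * ∑ j, hedge η g t j * g t j) := by
  have hlin : ∑ k, hedgeWeight η g (t + 1) k ≤ (∑ k, hedgeWeight η g t k) *
      (-(1 - Real.exp (-η)) * ∑ j, hedge η g t j * g t j + 1) :=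
    calc ∑ k, hedgeWeight η g (t + 1) k
        ≤ ∑ k, hedgeWeight η g t k * (1 - (1 - Real.exp (-η)) * g t k) :=
          Finset.sum_le_sum fun k _ => mul_le_mul_of_nonneg_left (exp_neg_mul_le η (hg k) (hg1 k))
            (hedgeWeight_pos η g t k).le
      _ = ∑ k, hedgeWeight η g t k -
          (1 - Real.exp (-η)) * ∑ k, hedgeWeight η g t k * g t k := by
          rw [Finset.mul_sum, ← Finset.sum_sub_distrib]
          exact Finset.sum_congr rfl fun k _ => by ring
      _ = _ := by rw [sum_hedgeWeight_mul]; ring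
  exact hlin.trans (mul_le_mul_of_nonneg_left (Real.add_one_le_exp _)
    (sum_hedgeWeight_pos η g t).le)

theorem sum_hedgeWeight_le (hg : ∀ t j, 0 ≤ g t j) (hg1 : ∀ t j, g t j ≤ 1) (n : ℕ) :
    ∑ k, hedgeWeight η g n k ≤ ℓ * Real.exp
      (-(1 - Real.exp (-η)) * ∑ t ∈ Finset.range n, ∑ j, hedge η g t j * g t j) := by
  induction n with
  | zero => simp [hedgeWeight]
  | succ n ih =>
    refine (sum_hedgeWeight_succ_le (hg n) (hg1 n)).trans ?_
    rw [Finset.sum_range_succ, mul_add, Real.exp_add, ← mul_assoc]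
    exact mul_le_mul_of_nonneg_right ih (Real.exp_pos _).le

theorem hedge_regret (hg : ∀ t j, 0 ≤ g t j) (hg1 : ∀ t j, g t j ≤ 1) (n : ℕ) (i : Fin ℓ) :
    (1 - Real.exp (-η)) * ∑ t ∈ Finset.range n, ∑ j, hedge η g t j * g t j ≤
      η * ∑ t ∈ Finset.range n, g t i + Real.log ℓ := by
  have hle : hedgeWeight η g n i ≤ ∑ k, hedgeWeight η g n k :=
    Finset.single_le_sum (fun k _ => (hedgeWeight_pos η g n k).le) (Finset.mem_univ i)
  rw [hedgeWeight_eq_exp] at hle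
  have hlog := Real.log_le_log (Real.exp_pos _) (hle.trans (sum_hedgeWeight_le hg hg1 n))
  rw [Real.log_exp, Real.log_mul (Nat.cast_ne_zero.2 (NeZero.ne ℓ)) (Real.exp_pos _).ne',
    Real.log_exp] at hlog
  linarith

end hedge

/-! ### Expectation over the coins and the explored heuristics -/

section product

variable {ι α R : Type*} [Fintype ι] [DecidableEq ι] [CommSemiring R] {w : ι → α → R} {s : ι}

theorem prod_apply_update_mul (u : ι → α) (a : α) :
    (∏ k, w k (Function.update u s a k)) * w s (u s) = (∏ k, w k (u k)) * w s a := by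
  have hrest : ∏ k ∈ Finset.univ.erase s, w k (Function.update u s a k) =
      ∏ k ∈ Finset.univ.erase s, w k (u k) :=
    Finset.prod_congr rfl fun k hk => by rw [Function.update_of_ne (Finset.ne_of_mem_erase hk)]
  rw [← Finset.mul_prod_erase _ _ (Finset.mem_univ s),
    ← Finset.mul_prod_erase _ (fun k => w k (u k)) (Finset.mem_univ s), Function.update_self, hrest,
    mul_right_comm, mul_comm (w s a), mul_right_comm]

-- Resample the coordinate `s` and exchange the two copies.
theorem sum_prod_mul_of_update_eq [Fintype α] (hw : ∑ a, w s a = 1) {φ : α → R} {G : (ι → α) → R}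
    (hG : ∀ u a, G (Function.update u s a) = G u) :
    ∑ u : ι → α, (∏ k, w k (u k)) * (φ (u s) * G u) =
      (∑ a, w s a * φ a) * ∑ u : ι → α, (∏ k, w k (u k)) * G u := by
  have hswap : Function.Involutive
      fun p : (ι → α) × α => (Function.update p.1 s p.2, p.1 s) := by
    rintro ⟨u, a⟩
    simp
  calc ∑ u : ι → α, (∏ k, w k (u k)) * (φ (u s) * G u)
      = ∑ u : ι → α, ∑ a, (∏ k, w k (u k)) * w s a * (φ (u s) * G u) := by
        simp_rw [← Finset.sum_mul, ← Finset.mul_sum, hw, mul_one]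
    _ = ∑ p : (ι → α) × α, (∏ k, w k (p.1 k)) * w s p.2 * (φ (p.1 s) * G p.1) :=
        (Fintype.sum_prod_type'
          fun (u : ι → α) a => (∏ k, w k (u k)) * w s a * (φ (u s) * G u)).symm
    _ = ∑ p : (ι → α) × α, (∏ k, w k (p.1 k)) * w s p.2 * (φ p.2 * G p.1) := by
        refine Fintype.sum_equiv (hswap.toPerm _) _ _ fun p => ?_
        simp only [Function.Involutive.coe_toPerm, hG, prod_apply_update_mul]
    _ = ∑ u : ι → α, ∑ a, (∏ k, w k (u k)) * w s a * (φ a * G u) :=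
        Fintype.sum_prod_type' fun (u : ι → α) a => (∏ k, w k (u k)) * w s a * (φ a * G u)
    _ = (∑ a, w s a * φ a) * ∑ u : ι → α, (∏ k, w k (u k)) * G u := by
        rw [Finset.sum_comm, Finset.sum_mul_sum]
        exact Finset.sum_congr rfl fun a _ => Finset.sum_congr rfl fun u _ => by ring

end product

theorem ext_apply {α : Type*} {n : ℕ} (u : Fin (n + 1) → α) (k : Fin (n + 1)) : ext u k = u k := by
  rw [ext, Fin.ofNat_val_eq_self]

theorem ext_update_of_ne {α : Type*} {n : ℕ} (u : Fin (n + 1) → α) {s t : ℕ} (hs : s ≤ n)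
    (ht : t ≤ n) (h : t ≠ s) (a : α) :
    ext (Function.update u (Fin.ofNat (n + 1) s) a) t = ext u t := by
  refine Function.update_of_ne (fun heq => h ?_) _ _
  have hval := congrArg Fin.val heq
  rwa [Fin.val_ofNat, Fin.val_ofNat, Nat.mod_eq_of_lt (by omega), Nat.mod_eq_of_lt (by omega)]
    at hval

/-- The probability mass function of the coin at time `s`. -/
def coinWeight (ε : ℝ) (s : ℕ) (b : Bool) : ℝ :=
  if s = 0 then (if b then 0 else 1) else if b then ε else 1 - ε

theorem sum_coinWeight (ε : ℝ) (s : ℕ) : ∑ b, coinWeight ε s b = 1 := by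
  by_cases h : s = 0 <;> simp [coinWeight, h]

theorem toReal_coinProb {T : ℕ} {ε : ℝ} (h0 : 0 ≤ ε) (h1 : ε ≤ 1) (β : Fin (T + 1) → Bool) :
    (coinProb T ε (ext β)).toReal = ∏ k : Fin (T + 1), coinWeight ε k (β k) := by
  have hIcc : ∏ k : Fin (T + 1), coinWeight ε k (β k) =
      coinWeight ε 0 (ext β 0) * ∏ t ∈ Finset.Icc 1 T, coinWeight ε t (ext β t) := by
    rw [← Finset.Ico_add_one_right_eq_Icc,
      ← Finset.prod_range_eq_mul_Ico (fun t => coinWeight ε t (ext β t)) T.add_one_pos,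
      ← Fin.prod_univ_eq_prod_range fun t => coinWeight ε t (ext β t)]
    simp only [ext_apply]
  rw [hIcc, coinProb, coinWeight, if_pos rfl]
  split_ifs
  · rw [ENNReal.toReal_zero, zero_mul]
  · rw [one_mul, ENNReal.toReal_prod]
    refine Finset.prod_congr rfl fun t ht => ?_
    rw [coinWeight, if_neg (Nat.one_le_iff_ne_zero.1 (Finset.mem_Icc.1 ht).1)]
    split_ifs
    exacts [ENNReal.toReal_ofReal h0, ENNReal.toReal_ofReal (sub_nonneg.2 h1)]

theorem coinProb_ne_top (T : ℕ) (ε : ℝ) (β : ℕ → Bool) : coinProb T ε β ≠ ∞ := by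
  rw [coinProb]
  split_ifs
  · exact ENNReal.zero_ne_top
  · refine ENNReal.prod_ne_top fun t _ => ?_
    split_ifs <;> exact ENNReal.ofReal_ne_top

section expect

variable {ℓ T m : ℕ} {ε : ℝ} {G G' : (ℕ → Bool) → (ℕ → Fin ℓ) → ℝ}

/-- The expectation of a function of the coins and of the explored heuristics. -/
def expect (T m : ℕ) (ε : ℝ) (G : (ℕ → Bool) → (ℕ → Fin ℓ) → ℝ) : ℝ :=
  ∑ β : Fin (T + 1) → Bool, ∑ e : Fin (T + m + 1) → Fin ℓ,
    (coinProb T ε (ext β)).toReal * (ℓ : ℝ)⁻¹ ^ (T + m + 1) * G (ext β) (ext e)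

theorem expect_mono_of_coin_zero (h : ∀ β e, β 0 = false → G β e ≤ G' β e) :
    expect T m ε G ≤ expect T m ε G' := by
  refine Finset.sum_le_sum fun β _ => Finset.sum_le_sum fun e _ => ?_
  cases hβ : ext β 0 with
  | false => exact mul_le_mul_of_nonneg_left (h _ _ hβ) (by positivity)
  | true => rw [coinProb, if_pos hβ, ENNReal.toReal_zero, zero_mul, zero_mul, zero_mul]

theorem expect_mono (h : ∀ β e, G β e ≤ G' β e) : expect T m ε G ≤ expect T m ε G' :=
  expect_mono_of_coin_zero fun β e _ => h β e

theorem expect_nonneg (h : ∀ β e, 0 ≤ G β e) : 0 ≤ expect T m ε G :=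
  Finset.sum_nonneg fun β _ => Finset.sum_nonneg fun e _ => mul_nonneg (by positivity) (h _ _)

theorem expect_add (G G' : (ℕ → Bool) → (ℕ → Fin ℓ) → ℝ) :
    expect T m ε (fun β e => G β e + G' β e) = expect T m ε G + expect T m ε G' := by
  simp only [expect, mul_add, Finset.sum_add_distrib]

theorem expect_sub (G G' : (ℕ → Bool) → (ℕ → Fin ℓ) → ℝ) :
    expect T m ε (fun β e => G β e - G' β e) = expect T m ε G - expect T m ε G' := by
  simp only [expect, mul_sub, Finset.sum_sub_distrib]

theorem expect_const_mul (a : ℝ) (G : (ℕ → Bool) → (ℕ → Fin ℓ) → ℝ) :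
    expect T m ε (fun β e => a * G β e) = a * expect T m ε G := by
  simp only [expect, Finset.mul_sum, mul_left_comm a]

theorem expect_sum {ι : Type*} (s : Finset ι) (G : ι → (ℕ → Bool) → (ℕ → Fin ℓ) → ℝ) :
    expect T m ε (fun β e => ∑ k ∈ s, G k β e) = ∑ k ∈ s, expect T m ε (G k) := by
  simp only [expect, Finset.mul_sum]
  simp only [Finset.sum_comm (t := s)]

theorem expect_const [NeZero ℓ] (h0 : 0 ≤ ε) (h1 : ε ≤ 1) (a : ℝ) :
    expect T m ε (fun _ (_ : ℕ → Fin ℓ) => a) = a := by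
  have he : ((ℓ ^ (T + m + 1) : ℕ) : ℝ) * (ℓ : ℝ)⁻¹ ^ (T + m + 1) = 1 := by
    rw [Nat.cast_pow, ← mul_pow, mul_inv_cancel₀ (Nat.cast_ne_zero.2 (NeZero.ne ℓ)), one_pow]
  have hβ : ∑ β : Fin (T + 1) → Bool, (coinProb T ε (ext β)).toReal = 1 := by
    simp only [toReal_coinProb h0 h1]
    rw [← Fintype.prod_sum fun (k : Fin (T + 1)) => coinWeight ε k]
    exact Finset.prod_eq_one fun k _ => sum_coinWeight ε k
  calc expect T m ε (fun _ (_ : ℕ → Fin ℓ) => a)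
      = ∑ β : Fin (T + 1) → Bool, (coinProb T ε (ext β)).toReal *
          (((ℓ ^ (T + m + 1) : ℕ) : ℝ) * (ℓ : ℝ)⁻¹ ^ (T + m + 1)) * a := by
        simp only [expect, Finset.sum_const, Finset.card_univ, Fintype.card_pi, Fintype.card_fin,
          Finset.prod_const, nsmul_eq_mul, mul_assoc, mul_left_comm (ENNReal.toReal _)]
    _ = a := by rw [he, ← Finset.sum_mul, ← Finset.sum_mul, hβ, one_mul, one_mul]

theorem expect_coin_mul (h0 : 0 ≤ ε) (h1 : ε ≤ 1) {s : ℕ} (hs : 1 ≤ s) (hsT : s ≤ T)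
    (hG : ∀ β β' e, (∀ u < s, β u = β' u) → G β e = G β' e) :
    expect T m ε (fun β e => (if β s then 1 else 0) * G β e) = ε * expect T m ε G := by
  rw [expect, expect, Finset.sum_comm, Finset.sum_comm (γ := Fin _ → Bool), Finset.mul_sum]
  refine Finset.sum_congr rfl fun e _ => ?_
  have hε : ∑ a, coinWeight ε (Fin.ofNat (T + 1) s) a * (if a = true then (1 : ℝ) else 0) = ε := by
    rw [Fin.val_ofNat, Nat.mod_eq_of_lt (by omega)]
    simp [coinWeight, Nat.one_le_iff_ne_zero.1 hs]
  have hindep := sum_prod_mul_of_update_eq (w := fun (k : Fin (T + 1)) b => coinWeight ε k b)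
    (s := Fin.ofNat (T + 1) s) (sum_coinWeight ε _) (φ := fun b => if b = true then 1 else 0)
    (G := fun β => (ℓ : ℝ)⁻¹ ^ (T + m + 1) * G (ext β) (ext e)) fun β b => congrArg _ <|
      hG _ _ _ fun u hu => ext_update_of_ne _ hsT (by omega) (by omega) _
  simp only [hε, ← toReal_coinProb h0 h1] at hindep
  simp only [mul_assoc, ← hindep]
  exact Finset.sum_congr rfl fun β _ => congrArg _ (mul_left_comm _ _ _)

theorem expect_coin_mul_le (h0 : 0 ≤ ε) (h1 : ε ≤ 1) {s : ℕ} (hsT : s ≤ T)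
    (hG0 : ∀ β e, 0 ≤ G β e) (hG : ∀ β β' e, (∀ u < s, β u = β' u) → G β e = G β' e) :
    expect T m ε (fun β e => (if β s then 1 else 0) * G β e) ≤ ε * expect T m ε G := by
  rcases Nat.eq_zero_or_pos s with rfl | hs
  · rw [← expect_const_mul]
    refine expect_mono_of_coin_zero fun β e hβ => ?_
    simpa [hβ] using mul_nonneg h0 (hG0 β e)
  · exact (expect_coin_mul h0 h1 hs hsT hG).le

theorem expect_explored_mul [NeZero ℓ] {t : ℕ} (ht : t ≤ T) (j : Fin ℓ)
    (hG : ∀ β e e', (∀ u < t, e u = e' u) → G β e = G β e') :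
    expect T m ε (fun β e => (if j = e t then 1 else 0) * G β e) =
      (ℓ : ℝ)⁻¹ * expect T m ε G := by
  have hℓ : (ℓ : ℝ) ≠ 0 := Nat.cast_ne_zero.2 (NeZero.ne ℓ)
  rw [expect, expect, Finset.mul_sum]
  refine Finset.sum_congr rfl fun β _ => ?_
  have hindep := sum_prod_mul_of_update_eq
    (w := fun (_ : Fin (T + m + 1)) (_ : Fin ℓ) => (ℓ : ℝ)⁻¹) (s := Fin.ofNat (T + m + 1) t)
    (by simp [hℓ]) (φ := fun i => if j = i then 1 else 0)
    (G := fun e => (coinProb T ε (ext β)).toReal * G (ext β) (ext e)) fun e i => congrArg _ <|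
      hG _ _ _ fun u hu => ext_update_of_ne _ (by omega) (by omega) (by omega) _
  simp only [Finset.prod_const, Finset.card_univ, Fintype.card_fin, mul_ite, mul_one, mul_zero,
    Finset.sum_ite_eq, Finset.mem_univ, if_true] at hindep
  simp only [mul_comm (ENNReal.toReal _) (_ ^ _), mul_assoc, ← hindep]
  exact Finset.sum_congr rfl fun e _ => by
    rw [show ext e t = e (Fin.ofNat _ t) from rfl]
    split_ifs <;> ring

end expect

/-! ### The exploited heuristics -/

section snoc

variable {α : Type*} {n : ℕ}

theorem ext_snoc_of_le (u : Fin (n + 1) → α) (a : α) {t : ℕ} (ht : t ≤ n) :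
    ext (Fin.snoc u a : Fin (n + 1 + 1) → α) t = ext u t := by
  have hcast : Fin.ofNat (n + 1 + 1) t = (Fin.ofNat (n + 1) t).castSucc := by
    ext
    rw [Fin.val_castSucc, Fin.val_ofNat, Fin.val_ofNat, Nat.mod_eq_of_lt (by omega),
      Nat.mod_eq_of_lt (by omega)]
  rw [ext, ext, hcast, Fin.snoc_castSucc]

theorem ext_snoc_last (u : Fin (n + 1) → α) (a : α) :
    ext (Fin.snoc u a : Fin (n + 1 + 1) → α) (n + 1) = a := by
  have hlast : Fin.ofNat (n + 1 + 1) (n + 1) = Fin.last (n + 1) := by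
    ext
    rw [Fin.val_ofNat, Nat.mod_eq_of_lt (by omega), Fin.val_last]
  rw [ext, hlast, Fin.snoc_last]

theorem sum_eq_sum_snoc {R : Type*} [AddCommMonoid R] [Fintype α] (F : (Fin (n + 1) → α) → R) :
    ∑ u, F u = ∑ u : Fin n → α, ∑ a, F (Fin.snoc u a) := by
  rw [← Equiv.sum_comp (Fin.snocEquiv fun _ => α), Fintype.sum_prod_type, Finset.sum_comm]
  rfl

end snoc

section path

variable {ℓ T : ℕ} {R : (Fin ℓ → ℝ) → (Fin ℓ → ℝ) → Fin ℓ → PMF (Fin ℓ)} {x : ℕ → Fin ℓ → ℝ}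

open Classical in
/-- The probability that the exploited heuristic at time `t` is `b` if the previous one is `a`. -/
def stepProb (R : (Fin ℓ → ℝ) → (Fin ℓ → ℝ) → Fin ℓ → PMF (Fin ℓ)) (x : ℕ → Fin ℓ → ℝ) (t : ℕ)
    (a b : Fin ℓ) : ℝ :=
  if x t ≠ x (t - 1) then (R (x (t - 1)) (x t) a b).toReal else if b = a then 1 else 0

theorem sum_stepProb (t : ℕ) (a : Fin ℓ) : ∑ b, stepProb R x t a b = 1 := by
  simp only [stepProb]
  split_ifs
  · have hsum : ∑ b, R (x (t - 1)) (x t) a b = 1 :=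
      (tsum_fintype _).symm.trans (PMF.tsum_coe _)
    rw [← ENNReal.toReal_sum fun b _ => PMF.apply_ne_top _ _, hsum, ENNReal.toReal_one]
  · rw [Finset.sum_ite_eq', if_pos (Finset.mem_univ a)]

theorem IsRound.exists_transport (hR : IsRound R) {t : ℕ}
    (hx : x (t - 1) ∈ stdSimplex ℝ (Fin ℓ)) (hx' : x t ∈ stdSimplex ℝ (Fin ℓ))
    (hpos : ∀ j, 0 < x (t - 1) j) :
    ∃ τ : Fin ℓ → Fin ℓ → ℝ, (∀ i j, x (t - 1) i * stepProb R x t i j = τ i j) ∧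
      (∀ j, ∑ i, τ i j = x t j) ∧
      ∑ i, ∑ j ∈ Finset.univ.erase i, τ i j = ∑ i, max 0 (x (t - 1) i - x t i) := by
  by_cases h : x t = x (t - 1)
  · refine ⟨fun i j => if j = i then x (t - 1) i else 0, fun i j => ?_, fun j => ?_, ?_⟩
    · rw [stepProb, if_neg (not_not.2 h), mul_ite, mul_one, mul_zero]
    · rw [Finset.sum_ite_eq, if_pos (Finset.mem_univ j), h]
    · simp only [h, sub_self, max_self, Finset.sum_const_zero]
      exact Finset.sum_eq_zero fun i _ => Finset.sum_eq_zero fun j hj =>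
        if_neg (Finset.ne_of_mem_erase hj)
  · obtain ⟨τ, hτ, -, hcol, hmoved, hprob⟩ := hR _ hx _ hx'
    refine ⟨τ, fun i j => ?_, hcol, hmoved⟩
    rw [stepProb, if_pos h, hprob i (hpos i).ne' j,
      ENNReal.toReal_ofReal (div_nonneg (hτ i j) (hpos i).le), mul_div_cancel₀ _ (hpos i).ne']

theorem toReal_pathProb (i : ℕ → Fin ℓ) :
    (pathProb R T x i).toReal =
      (ℓ : ℝ)⁻¹ * ∏ t ∈ Finset.Icc 1 T, stepProb R x t (i (t - 1)) (i t) := by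
  rw [pathProb, ENNReal.toReal_mul, ENNReal.toReal_prod, ENNReal.toReal_inv, ENNReal.toReal_natCast]
  refine congrArg _ (Finset.prod_congr rfl fun t _ => ?_)
  rw [stepProb]
  split_ifs
  exacts [rfl, ENNReal.toReal_one, ENNReal.toReal_zero]

theorem pathProb_ne_top [NeZero ℓ] (R : (Fin ℓ → ℝ) → (Fin ℓ → ℝ) → Fin ℓ → PMF (Fin ℓ)) (T : ℕ)
    (x : ℕ → Fin ℓ → ℝ) (i : ℕ → Fin ℓ) : pathProb R T x i ≠ ∞ := by
  rw [pathProb]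
  refine ENNReal.mul_ne_top (by simp [NeZero.ne ℓ]) (ENNReal.prod_ne_top fun t _ => ?_)
  split_ifs
  exacts [PMF.apply_ne_top _ _, ENNReal.one_ne_top, ENNReal.zero_ne_top]

theorem pathProb_congr {x' : ℕ → Fin ℓ → ℝ} (h : ∀ t ≤ T, x t = x' t) (i : ℕ → Fin ℓ) :
    pathProb R T x i = pathProb R T x' i := by
  rw [pathProb, pathProb]
  refine congrArg _ (Finset.prod_congr rfl fun t ht => ?_)
  rw [Finset.mem_Icc] at ht
  rw [h t ht.2, h (t - 1) (by omega)]

theorem eq_of_pathProb_ne_zero {i : ℕ → Fin ℓ} (h : pathProb R T x i ≠ 0) {t : ℕ}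
    (ht : t ∈ Finset.Icc 1 T) (hx : x t = x (t - 1)) : i t = i (t - 1) := by
  rw [pathProb] at h
  have hstep := Finset.prod_ne_zero_iff.1 (right_ne_zero_of_mul h) t ht
  rw [if_neg (not_not.2 hx)] at hstep
  exact of_not_not fun hne => hstep (if_neg hne)

/-- The expectation of a function of the exploited heuristics, if HEDGE plays the distributions
`x`. -/
def pathExpect (R : (Fin ℓ → ℝ) → (Fin ℓ → ℝ) → Fin ℓ → PMF (Fin ℓ)) (T : ℕ)
    (x : ℕ → Fin ℓ → ℝ) (h : (ℕ → Fin ℓ) → ℝ) : ℝ :=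
  ∑ i : Fin (T + 1) → Fin ℓ, (pathProb R T x (ext i)).toReal * h (ext i)

theorem pathExpect_add (h h' : (ℕ → Fin ℓ) → ℝ) :
    pathExpect R T x (fun i => h i + h' i) = pathExpect R T x h + pathExpect R T x h' := by
  simp only [pathExpect, mul_add, Finset.sum_add_distrib]

theorem pathExpect_const_mul (a : ℝ) (h : (ℕ → Fin ℓ) → ℝ) :
    pathExpect R T x (fun i => a * h i) = a * pathExpect R T x h := by
  simp only [pathExpect, Finset.mul_sum, mul_left_comm a]

theorem pathExpect_sum {ι : Type*} (s : Finset ι) (h : ι → (ℕ → Fin ℓ) → ℝ) :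
    pathExpect R T x (fun i => ∑ k ∈ s, h k i) = ∑ k ∈ s, pathExpect R T x (h k) := by
  simp only [pathExpect, Finset.mul_sum]
  exact Finset.sum_comm

theorem pathExpect_succ {h : (ℕ → Fin ℓ) → ℝ}
    (hh : ∀ u v, (∀ s ≤ T + 1, u s = v s) → h u = h v) :
    pathExpect R (T + 1) x h = pathExpect R T x fun i =>
      ∑ b, stepProb R x (T + 1) (i T) b * h (Function.update i (T + 1) b) := by
  rw [pathExpect, sum_eq_sum_snoc, pathExpect]
  refine Finset.sum_congr rfl fun u _ => ?_
  rw [Finset.mul_sum]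
  refine Finset.sum_congr rfl fun b _ => ?_
  have hprod : ∏ t ∈ Finset.Icc 1 T, stepProb R x t
      (ext (Fin.snoc u b : Fin (T + 1 + 1) → Fin ℓ) (t - 1)) (ext (Fin.snoc u b) t) =
      ∏ t ∈ Finset.Icc 1 T, stepProb R x t (ext u (t - 1)) (ext u t) :=
    Finset.prod_congr rfl fun t ht => by
      rw [Finset.mem_Icc] at ht
      rw [ext_snoc_of_le _ _ ht.2, ext_snoc_of_le _ _ (by omega)]
  have hupdate : h (ext (Fin.snoc u b : Fin (T + 1 + 1) → Fin ℓ)) =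
      h (Function.update (ext u) (T + 1) b) := hh _ _ fun s hs => by
    rcases hs.eq_or_lt with rfl | hlt
    · rw [ext_snoc_last, Function.update_self]
    · rw [ext_snoc_of_le _ _ (by omega), Function.update_of_ne (by omega)]
  rw [toReal_pathProb, toReal_pathProb, Finset.prod_Icc_succ_top (by omega), hprod, hupdate,
    Nat.add_sub_cancel, ext_snoc_last, ext_snoc_of_le _ _ le_rfl, ← mul_assoc, ← mul_assoc]

theorem pathExpect_of_le {h : (ℕ → Fin ℓ) → ℝ} {t : ℕ} (ht : t ≤ T)
    (hh : ∀ u v, (∀ s ≤ t, u s = v s) → h u = h v) :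
    pathExpect R T x h = pathExpect R t x h := by
  induction T, ht using Nat.le_induction with
  | base => rfl
  | succ T hT ih =>
    have hupdate : ∀ i b, h (Function.update i (T + 1) b) = h i := fun i b =>
      hh _ _ fun s hs => Function.update_of_ne (by omega) _ _
    rw [pathExpect_succ fun u v huv => hh u v fun s hs => huv s (by omega), ← ih]
    simp only [hupdate, ← Finset.sum_mul, sum_stepProb, one_mul]

section marginal

variable (hR : IsRound R) (hx : ∀ t, x t ∈ stdSimplex ℝ (Fin ℓ)) (hpos : ∀ t j, 0 < x t j)
  (hx0 : ∀ j, x 0 j = (ℓ : ℝ)⁻¹)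

include hR hx hpos hx0

theorem pathExpect_last (φ : Fin ℓ → ℝ) (t : ℕ) :
    pathExpect R t x (fun i => φ (i t)) = ∑ j, x t j * φ j := by
  induction t generalizing φ with
  | zero =>
    rw [pathExpect, ← Equiv.sum_comp (Equiv.funUnique (Fin 1) (Fin ℓ)).symm]
    refine Finset.sum_congr rfl fun j _ => ?_
    rw [toReal_pathProb, hx0, Finset.Icc_eq_empty (by norm_num), Finset.prod_empty, mul_one]
    rfl
  | succ t ih =>
    obtain ⟨τ, hτ, hcol, -⟩ := hR.exists_transport (hx _) (hx (t + 1)) (hpos _)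
    rw [Nat.add_sub_cancel] at hτ
    rw [pathExpect_succ fun u v huv => by rw [huv _ le_rfl]]
    simp only [Function.update_self]
    rw [ih fun a => ∑ b, stepProb R x (t + 1) a b * φ b]
    simp only [Finset.mul_sum, ← mul_assoc, hτ]
    rw [Finset.sum_comm]
    exact Finset.sum_congr rfl fun b _ => by rw [← Finset.sum_mul, hcol]

theorem pathExpect_apply (φ : Fin ℓ → ℝ) {t : ℕ} (ht : t ≤ T) :
    pathExpect R T x (fun i => φ (i t)) = ∑ j, x t j * φ j := by
  rw [pathExpect_of_le ht fun u v huv => by rw [huv _ le_rfl],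
    pathExpect_last hR hx hpos hx0]

theorem pathExpect_switch {t : ℕ} (ht : t + 1 ≤ T) :
    pathExpect R T x (fun i => if i (t + 1) ≠ i t then 1 else 0) =
      ∑ j, max 0 (x t j - x (t + 1) j) := by
  obtain ⟨τ, hτ, -, hmoved⟩ := hR.exists_transport (hx _) (hx (t + 1)) (hpos _)
  rw [Nat.add_sub_cancel] at hτ hmoved
  rw [pathExpect_of_le ht fun u v huv => by rw [huv _ le_rfl, huv t (by omega)],
    pathExpect_succ fun u v huv => by rw [huv _ le_rfl, huv t (by omega)]]
  simp only [Function.update_self, Function.update_of_ne (show t ≠ t + 1 by omega)]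
  rw [pathExpect_last hR hx hpos hx0
    fun a => ∑ b, stepProb R x (t + 1) a b * (if b ≠ a then 1 else 0), ← hmoved]
  refine Finset.sum_congr rfl fun a _ => ?_
  simp only [Finset.mul_sum, hτ, mul_ite, mul_one, mul_zero]
  rw [← Finset.sum_filter, Finset.filter_ne']

end marginal

end path

/-! ### The learner as a function of the coins and the explored heuristics -/

section learner

variable {ℓ : ℕ}

/-- The loss vector at time `t` if the heuristics have costs `f`. Unlike `loss`, it does not refer
to the answers, and hence not to the exploited heuristics either. -/
def explorationLoss (D : ℝ) (f : ℕ → Fin ℓ → ℝ) (m : ℕ) (β : ℕ → Bool) (e : ℕ → Fin ℓ) (t : ℕ)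
    (j : Fin ℓ) : ℝ :=
  if timer m β t = 1 ∧ j = e t then f t j / (2 * D) else 0

/-- The distribution of HEDGE at time `t` for the losses `explorationLoss`. -/
def learned (D η : ℝ) (f : ℕ → Fin ℓ → ℝ) (m : ℕ) (β : ℕ → Bool) (e : ℕ → Fin ℓ) (t : ℕ) :
    Fin ℓ → ℝ :=
  hedge η (explorationLoss D f m β e) t

/-- The cost at time `t` of a heuristic drawn from the distribution of HEDGE at time `s`, averaged
over this draw. -/
def meanCost (D η : ℝ) (f : ℕ → Fin ℓ → ℝ) (m : ℕ) (s t : ℕ) (β : ℕ → Bool) (e : ℕ → Fin ℓ) : ℝ :=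
  ∑ j, learned D η f m β e s j * f t j

/-- The loss of HEDGE at time `t`. -/
def meanLoss (D η : ℝ) (f : ℕ → Fin ℓ → ℝ) (m : ℕ) (t : ℕ) (β : ℕ → Bool) (e : ℕ → Fin ℓ) : ℝ :=
  ∑ j, learned D η f m β e t j * explorationLoss D f m β e t j

/-- The mass moved by HEDGE from time `t - 1` to time `t`; this is the probability of a switch of
the exploited heuristic. -/
def movedMass (D η : ℝ) (f : ℕ → Fin ℓ → ℝ) (m : ℕ) (t : ℕ) (β : ℕ → Bool) (e : ℕ → Fin ℓ) : ℝ :=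
  ∑ j, max 0 (learned D η f m β e (t - 1) j - learned D η f m β e t j)

/-- The mean cost of following the exploited heuristic at time `t`, where each switch is charged
the diameter `D`. -/
def meanStep (D η : ℝ) (f : ℕ → Fin ℓ → ℝ) (m t : ℕ) (β : ℕ → Bool) (e : ℕ → Fin ℓ) : ℝ :=
  meanCost D η f m t t β e + D * movedMass D η f m t β e

/-- The backlog of the mean costs of following the exploited heuristic. -/
def meanBacklog (D η : ℝ) (f : ℕ → Fin ℓ → ℝ) (m t : ℕ) (β : ℕ → Bool) (e : ℕ → Fin ℓ) : ℝ :=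
  backlog m β (fun u => meanStep D η f m u β e) t

variable {D η : ℝ} {f : ℕ → Fin ℓ → ℝ} {m s t : ℕ} {β β' : ℕ → Bool} {e e' : ℕ → Fin ℓ}

theorem explorationLoss_congr (hβ : ∀ u < t, β u = β' u) (he : e t = e' t) :
    explorationLoss D f m β e t = explorationLoss D f m β' e' t := by
  ext j
  rw [explorationLoss, explorationLoss, timer_congr hβ, he]

theorem learned_congr (hβ : ∀ u < t, β u = β' u) (he : ∀ u < t, e u = e' u) :
    learned D η f m β e t = learned D η f m β' e' t :=
  hedge_congr fun u hu => explorationLoss_congr (fun v hv => hβ v (hv.trans hu)) (he u hu)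

theorem meanCost_congr (hβ : ∀ u < s, β u = β' u) (he : ∀ u < s, e u = e' u) :
    meanCost D η f m s t β e = meanCost D η f m s t β' e' := by
  rw [meanCost, meanCost, learned_congr hβ he]

theorem movedMass_congr (hβ : ∀ u < t, β u = β' u) (he : ∀ u < t, e u = e' u) :
    movedMass D η f m t β e = movedMass D η f m t β' e' := by
  rw [movedMass, movedMass, learned_congr hβ he,
    learned_congr (t := t - 1) (fun u hu => hβ u (by omega)) fun u hu => he u (by omega)]

theorem meanStep_congr (hβ : ∀ u < t, β u = β' u) (he : ∀ u < t, e u = e' u) :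
    meanStep D η f m t β e = meanStep D η f m t β' e' := by
  rw [meanStep, meanStep, meanCost_congr hβ he, movedMass_congr hβ he]

theorem meanBacklog_congr (hβ : ∀ u < t, β u = β' u) (he : ∀ u < t, e u = e' u) :
    meanBacklog D η f m t β e = meanBacklog D η f m t β' e' :=
  backlog_congr hβ fun u hu =>
    meanStep_congr (fun v hv => hβ v (by omega)) fun v hv => he v (by omega)

theorem explorationLoss_eq_zero (h : timer m β t ≠ 1) (j : Fin ℓ) :
    explorationLoss D f m β e t j = 0 :=
  if_neg fun h' => h h'.1

theorem learned_succ_of_timer_ne_one (h : timer m β t ≠ 1) :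
    learned D η f m β e (t + 1) = learned D η f m β e t :=
  hedge_succ_of_eq_zero fun j => explorationLoss_eq_zero h j

theorem explorationLoss_nonneg (hD : 0 ≤ D) (hf0 : ∀ t j, 0 ≤ f t j) (β : ℕ → Bool)
    (e : ℕ → Fin ℓ) (t : ℕ) (j : Fin ℓ) : 0 ≤ explorationLoss D f m β e t j := by
  rw [explorationLoss]
  split_ifs
  exacts [div_nonneg (hf0 t j) (by linarith), le_rfl]

theorem explorationLoss_le_one (hD : 0 ≤ D) (hf1 : ∀ t j, f t j ≤ 2 * D) (β : ℕ → Bool)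
    (e : ℕ → Fin ℓ) (t : ℕ) (j : Fin ℓ) : explorationLoss D f m β e t j ≤ 1 := by
  rw [explorationLoss]
  split_ifs
  exacts [div_le_one_of_le₀ (hf1 t j) (by linarith), zero_le_one]

theorem movedMass_nonneg (t : ℕ) (β : ℕ → Bool) (e : ℕ → Fin ℓ) : 0 ≤ movedMass D η f m t β e :=
  Finset.sum_nonneg fun _ _ => le_max_left _ _

theorem movedMass_zero (β : ℕ → Bool) (e : ℕ → Fin ℓ) : movedMass D η f m 0 β e = 0 :=
  Finset.sum_eq_zero fun j _ => by rw [Nat.zero_sub, sub_self, max_self]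

variable [NeZero ℓ]

theorem learned_pos (β : ℕ → Bool) (e : ℕ → Fin ℓ) (t : ℕ) (j : Fin ℓ) :
    0 < learned D η f m β e t j :=
  hedge_pos _ _ _ _

theorem sum_learned (β : ℕ → Bool) (e : ℕ → Fin ℓ) (t : ℕ) :
    ∑ j, learned D η f m β e t j = 1 :=
  sum_hedge _ _ _

theorem movedMass_le_one (t : ℕ) (β : ℕ → Bool) (e : ℕ → Fin ℓ) :
    movedMass D η f m t β e ≤ 1 := by
  rw [← sum_learned (D := D) (η := η) (f := f) (m := m) β e (t - 1)]
  exact Finset.sum_le_sum fun j _ =>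
    max_le (learned_pos β e _ j).le (sub_le_self _ (learned_pos β e t j).le)

theorem meanCost_nonneg (hf0 : ∀ t j, 0 ≤ f t j) (s t : ℕ) (β : ℕ → Bool) (e : ℕ → Fin ℓ) :
    0 ≤ meanCost D η f m s t β e :=
  Finset.sum_nonneg fun j _ => mul_nonneg (learned_pos β e s j).le (hf0 t j)

theorem meanCost_le (hf1 : ∀ t j, f t j ≤ 2 * D) (s t : ℕ) (β : ℕ → Bool) (e : ℕ → Fin ℓ) :
    meanCost D η f m s t β e ≤ 2 * D :=
  calc meanCost D η f m s t β e ≤ ∑ j, learned D η f m β e s j * (2 * D) :=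
        Finset.sum_le_sum fun j _ => mul_le_mul_of_nonneg_left (hf1 t j) (learned_pos β e s j).le
    _ = 2 * D := by rw [← Finset.sum_mul, sum_learned, one_mul]

section bounds

variable (hD : 0 ≤ D) (hf0 : ∀ t j, 0 ≤ f t j)

include hD

theorem meanStep_le (hf1 : ∀ t j, f t j ≤ 2 * D) (t : ℕ) (β : ℕ → Bool) (e : ℕ → Fin ℓ) :
    meanStep D η f m t β e ≤ 3 * D := by
  rw [meanStep]
  linarith [meanCost_le (η := η) (m := m) hf1 t t β e, mul_le_mul_of_nonneg_left
    (movedMass_le_one (D := D) (η := η) (f := f) (m := m) t β e) hD]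

include hf0

theorem meanStep_nonneg (t : ℕ) (β : ℕ → Bool) (e : ℕ → Fin ℓ) : 0 ≤ meanStep D η f m t β e :=
  add_nonneg (meanCost_nonneg hf0 t t β e) (mul_nonneg hD (movedMass_nonneg t β e))

theorem meanBacklog_nonneg (t : ℕ) (β : ℕ → Bool) (e : ℕ → Fin ℓ) :
    0 ≤ meanBacklog D η f m t β e :=
  backlog_nonneg (fun u => meanStep_nonneg hD hf0 u β e) t

theorem meanBacklog_le (hf1 : ∀ t j, f t j ≤ 2 * D) (t : ℕ) (β : ℕ → Bool) (e : ℕ → Fin ℓ) :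
    meanBacklog D η f m t β e ≤ (if t < m then m * (3 * D) else 0) +
      (∑ s ∈ Finset.Ico (t - 2 * m) t, (if β s then 1 else 0) *
        (meanBacklog D η f m (t - 2 * m) β e +
          ∑ u ∈ Finset.Ioc (t - 2 * m) t, meanCost D η f m u u β e)) +
      ∑ u ∈ Finset.Ioc (t - 2 * m) t, D * movedMass D η f m u β e :=
  backlog_add_le (fun u => meanCost_nonneg hf0 u u β e)
    (fun u => mul_nonneg hD (movedMass_nonneg u β e)) (fun u => meanStep_le hD hf1 u β e) t

theorem meanLoss_nonneg (t : ℕ) (β : ℕ → Bool) (e : ℕ → Fin ℓ) : 0 ≤ meanLoss D η f m t β e :=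
  Finset.sum_nonneg fun j _ =>
    mul_nonneg (learned_pos β e t j).le (explorationLoss_nonneg hD hf0 β e t j)

theorem movedMass_succ_le (hη : 0 ≤ η) (t : ℕ) (β : ℕ → Bool) (e : ℕ → Fin ℓ) :
    movedMass D η f m (t + 1) β e ≤ η * meanLoss D η f m t β e :=
  sum_max_hedge_sub_succ_le hη fun j => explorationLoss_nonneg hD hf0 β e t j

end bounds

/-! ### Stability of the learner -/

section stability

variable (hD : 0 ≤ D) (hf0 : ∀ t j, 0 ≤ f t j) (hf1 : ∀ t j, f t j ≤ 2 * D) (hη : 0 ≤ η)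
  (β : ℕ → Bool) (e : ℕ → Fin ℓ)

include hD hf0 hf1 hη

theorem exp_neg_pow_mul_learned_le_of_le (hst : s ≤ t) (j : Fin ℓ) :
    Real.exp (-η) ^ ((Finset.Ico s t).filter fun u => timer m β u = 1).card *
      learned D η f m β e s j ≤ learned D η f m β e t j := by
  induction t, hst using Nat.le_induction with
  | base => rw [Finset.Ico_self, Finset.filter_empty, Finset.card_empty, pow_zero, one_mul]
  | succ t hst ih =>
    rw [← Finset.insert_Ico_right_eq_Ico_add_one hst, Finset.filter_insert]
    split_ifs with h
    · rw [Finset.card_insert_of_notMem (by simp), pow_succ', mul_assoc]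
      exact (mul_le_mul_of_nonneg_left ih (Real.exp_pos _).le).trans
        (exp_neg_mul_hedge_le_succ hη (explorationLoss_nonneg hD hf0 β e t)
          (explorationLoss_le_one hD hf1 β e t) j)
    · rwa [learned_succ_of_timer_ne_one h]

theorem exp_neg_pow_mul_learned_le_of_ge (hst : s ≤ t) (j : Fin ℓ) :
    Real.exp (-η) ^ ((Finset.Ico s t).filter fun u => timer m β u = 1).card *
      learned D η f m β e t j ≤ learned D η f m β e s j := by
  induction t, hst using Nat.le_induction with
  | base => rw [Finset.Ico_self, Finset.filter_empty, Finset.card_empty, pow_zero, one_mul]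
  | succ t hst ih =>
    rw [← Finset.insert_Ico_right_eq_Ico_add_one hst, Finset.filter_insert]
    split_ifs with h
    · rw [Finset.card_insert_of_notMem (by simp), pow_succ, mul_assoc]
      exact (mul_le_mul_of_nonneg_left (exp_neg_mul_hedge_succ_le hη
        (explorationLoss_nonneg hD hf0 β e t) (explorationLoss_le_one hD hf1 β e t) j)
        (by positivity)).trans ih
    · rwa [learned_succ_of_timer_ne_one h]

theorem exp_neg_mul_learned_le (hst : s ≤ t + m + 1) (hts : t ≤ s + m + 1) (j : Fin ℓ) :
    Real.exp (-η) * learned D η f m β e s j ≤ learned D η f m β e t j := by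
  have hpow : ∀ {u v : ℕ}, v ≤ u + m + 1 → Real.exp (-η) * learned D η f m β e s j ≤
      Real.exp (-η) ^ ((Finset.Ico u v).filter fun u => timer m β u = 1).card *
        learned D η f m β e s j := fun huv =>
    mul_le_mul_of_nonneg_right ((pow_one (Real.exp (-η))).symm.trans_le
      (pow_le_pow_of_le_one (Real.exp_pos _).le (Real.exp_le_one_iff.2 (neg_nonpos.2 hη))
        (card_filter_timer_eq_one_le_one huv))) (learned_pos β e s j).le
  rcases le_total s t with h | h
  · exact (hpow hts).trans (exp_neg_pow_mul_learned_le_of_le hD hf0 hf1 hη β e h j)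
  · exact (hpow hst).trans (exp_neg_pow_mul_learned_le_of_ge hD hf0 hf1 hη β e h j)

theorem exp_neg_mul_meanCost_le {s' : ℕ} (h : s ≤ s' + m + 1) (h' : s' ≤ s + m + 1) (t : ℕ) :
    Real.exp (-η) * meanCost D η f m s t β e ≤ meanCost D η f m s' t β e := by
  rw [meanCost, Finset.mul_sum]
  refine Finset.sum_le_sum fun j _ => ?_
  rw [← mul_assoc]
  exact mul_le_mul_of_nonneg_right (exp_neg_mul_learned_le hD hf0 hf1 hη β e h h' j) (hf0 t j)

theorem exp_neg_sq_mul_meanCost_le {s' : ℕ} (h : s ≤ s' + 2 * m) (h' : s' ≤ s + 2 * m) (t : ℕ) :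
    Real.exp (-η) ^ 2 * meanCost D η f m s t β e ≤ meanCost D η f m s' t β e := by
  obtain ⟨u, hsu, hus, hus', hs'u⟩ :
      ∃ u, s ≤ u + m + 1 ∧ u ≤ s + m + 1 ∧ u ≤ s' + m + 1 ∧ s' ≤ u + m + 1 := by
    rcases le_total s s' with hle | hle
    · exact ⟨min (s + m) s', by omega, by omega, by omega, by omega⟩
    · exact ⟨min (s' + m) s, by omega, by omega, by omega, by omega⟩
  rw [pow_two, mul_assoc]
  exact (mul_le_mul_of_nonneg_left (exp_neg_mul_meanCost_le hD hf0 hf1 hη β e hsu hus t)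
    (Real.exp_pos _).le).trans (exp_neg_mul_meanCost_le hD hf0 hf1 hη β e hus' hs'u t)

end stability

end learner

/-! ### Sums over time -/

theorem sum_sub_le_sum {a : ℕ → ℝ} (h0 : a 0 = 0) (ha : ∀ t, 0 ≤ a t) (k n : ℕ) :
    ∑ t ∈ Finset.range n, a (t - k) ≤ ∑ t ∈ Finset.range n, a t := by
  have hshift : ∑ t ∈ Finset.range n, a (t - k) = ∑ t ∈ Finset.range (n - k), a t := by
    induction n with
    | zero => rw [Nat.zero_sub, Finset.sum_range_zero, Finset.sum_range_zero]
    | succ n ih =>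
      rw [Finset.sum_range_succ, ih]
      rcases Nat.lt_or_ge n k with h | h
      · rw [show n - k = 0 by omega, show n + 1 - k = 0 by omega, h0, add_zero]
      · rw [show n + 1 - k = n - k + 1 by omega, Finset.sum_range_succ]
  rw [hshift]
  exact Finset.sum_le_sum_of_subset_of_nonneg (Finset.range_mono (Nat.sub_le n k))
    fun t _ _ => ha t

theorem sum_sum_Ioc_le {a : ℕ → ℝ} (ha : ∀ t, 0 ≤ a t) (k n : ℕ) :
    ∑ t ∈ Finset.range n, ∑ u ∈ Finset.Ioc (t - k) t, a u ≤ k * ∑ t ∈ Finset.range n, a t := by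
  rw [Finset.sum_comm' (t' := Finset.range n)
    (s' := fun u => (Finset.range n).filter fun t => u ∈ Finset.Ioc (t - k) t) (fun t u => by
      simp only [Finset.mem_range, Finset.mem_Ioc, Finset.mem_filter]
      omega), Finset.mul_sum]
  refine Finset.sum_le_sum fun u _ => ?_
  have hcard : ((Finset.range n).filter fun t => u ∈ Finset.Ioc (t - k) t).card ≤
      (Finset.Ico u (u + k)).card := Finset.card_le_card fun t ht => by
    simp only [Finset.mem_range, Finset.mem_Ioc, Finset.mem_filter] at ht
    exact Finset.mem_Ico.2 (by omega)
  rw [Nat.card_Ico, Nat.add_sub_cancel_left] at hcard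
  rw [Finset.sum_const, nsmul_eq_mul]
  exact mul_le_mul_of_nonneg_right (Nat.cast_le.2 hcard) (ha u)

theorem sum_range_ite_lt_le {c : ℝ} (hc : 0 ≤ c) (k n : ℕ) :
    ∑ t ∈ Finset.range n, (if t < k then c else 0) ≤ k * c := by
  have hcard : ((Finset.range n).filter fun t => t < k).card ≤ (Finset.range k).card :=
    Finset.card_le_card fun t ht => Finset.mem_range.2 (Finset.mem_filter.1 ht).2
  rw [Finset.card_range] at hcard
  rw [← Finset.sum_filter, Finset.sum_const, nsmul_eq_mul]
  exact mul_le_mul_of_nonneg_right (Nat.cast_le.2 hcard) hc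

theorem one_sub_mul_sum_le_of_delayed_recursion {V p Z : ℕ → ℝ} {a : ℝ} {k n : ℕ} (ha : 0 ≤ a)
    (hV0 : V 0 = 0) (hV : ∀ t, 0 ≤ V t) (hZ : ∀ t, 0 ≤ Z t)
    (h : ∀ t < n, V t ≤ p t + a * V (t - k) + ∑ u ∈ Finset.Ioc (t - k) t, Z u) :
    (1 - a) * ∑ t ∈ Finset.range n, V t ≤
      ∑ t ∈ Finset.range n, p t + k * ∑ t ∈ Finset.range n, Z t := by
  have hsum := Finset.sum_le_sum fun t ht => h t (Finset.mem_range.1 ht)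
  rw [Finset.sum_add_distrib, Finset.sum_add_distrib, ← Finset.mul_sum] at hsum
  have hdelay := mul_le_mul_of_nonneg_left (sum_sub_le_sum hV0 hV k n) ha
  linarith [sum_sum_Ioc_le hZ k n]

/-! ### Expected costs -/

section expected

theorem nonneg_of_exp_neg_eq {η γ : ℝ} (hη : Real.exp (-η) = 1 - γ) (hγ0 : 0 ≤ γ) : 0 ≤ η :=
  neg_nonpos.1 (Real.exp_le_one_iff.1 (hη.trans_le (sub_le_self 1 hγ0)))

variable {ℓ : ℕ} [NeZero ℓ] {D η ε γ : ℝ} {f : ℕ → Fin ℓ → ℝ} {m T s t : ℕ}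

theorem sub_sum_coin_mul_le {y : ℝ} (hy : 0 ≤ y) (m t : ℕ) (β : ℕ → Bool) :
    y - ∑ u ∈ Finset.Ico (t - m) t, (if β u then 1 else 0) * y ≤
      (if timer m β t = 0 then 1 else 0) * y := by
  have hnonneg : ∀ u ∈ Finset.Ico (t - m) t, (0 : ℝ) ≤ (if β u then 1 else 0) * y :=
    fun u _ => mul_nonneg (by split_ifs <;> norm_num) hy
  by_cases htimer : timer m β t = 0
  · rw [if_pos htimer, one_mul]
    exact sub_le_self y (Finset.sum_nonneg hnonneg)
  · obtain ⟨u, hu, hβ⟩ := exists_coin_of_timer_ne_zero htimer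
    have hone := Finset.single_le_sum hnonneg hu
    rw [if_pos hβ, one_mul] at hone
    rw [if_neg htimer, zero_mul]
    exact sub_nonpos.2 hone

theorem expect_timer_eq_one_le (hε0 : 0 ≤ ε) (hε1 : ε ≤ 1) (ht : t ≤ T) :
    expect T m ε (fun β (_ : ℕ → Fin ℓ) => if timer m β t = 1 then 1 else 0) ≤ ε := by
  have hcoin := expect_coin_mul_le (ℓ := ℓ) (m := m) hε0 hε1 (s := t - m) (T := T) (by omega)
    (G := fun _ _ => 1) (fun _ _ => zero_le_one) fun _ _ _ _ => rfl
  rw [expect_const hε0 hε1, mul_one] at hcoin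
  refine (expect_mono fun β _ => ?_).trans hcoin
  by_cases h : timer m β t = 1
  · obtain ⟨s, -, heq, -, hβ⟩ := exists_start_of_timer_ne_zero (h.trans_ne one_ne_zero)
    obtain rfl : s = t - m := by omega
    rw [if_pos h, if_pos hβ, one_mul]
  · rw [if_neg h]
    split_ifs <;> norm_num

theorem expect_meanLoss (ht : t ≤ T) :
    expect T m ε (meanLoss D η f m t) = (2 * D)⁻¹ * ((ℓ : ℝ)⁻¹ * expect T m ε
      (fun β e => (if timer m β t = 1 then 1 else 0) * meanCost D η f m t t β e)) := by
  have hterm : ∀ j : Fin ℓ,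
      expect T m ε (fun β e => learned D η f m β e t j * explorationLoss D f m β e t j) =
      (2 * D)⁻¹ * ((ℓ : ℝ)⁻¹ * expect T m ε fun β e =>
        (if timer m β t = 1 then 1 else 0) * (learned D η f m β e t j * f t j)) := fun j => by
    rw [← expect_explored_mul ht j fun β e e' h => by rw [learned_congr (fun _ _ => rfl) h],
      ← expect_const_mul]
    congr 1 with β e
    rw [explorationLoss, ite_and]
    split_ifs <;> ring
  calc expect T m ε (meanLoss D η f m t)
      = ∑ j, expect T m ε
          (fun β e => learned D η f m β e t j * explorationLoss D f m β e t j) := expect_sum _ _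
    _ = _ := by
        simp only [hterm, meanCost, ← Finset.mul_sum, ← expect_sum]

section nonneg

variable (hD : 0 ≤ D) (hf0 : ∀ t j, 0 ≤ f t j)

include hD hf0

theorem expect_explorationLoss_le (hε0 : 0 ≤ ε) (hε1 : ε ≤ 1) (ht : t ≤ T) (i : Fin ℓ) :
    expect T m ε (fun β e => explorationLoss D f m β e t i) ≤
      (2 * D)⁻¹ * ((ℓ : ℝ)⁻¹ * (ε * f t i)) := by
  have hloss : (fun β e => explorationLoss D f m β e t i) = fun β (e : ℕ → Fin ℓ) =>
      (if i = e t then 1 else 0) *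
        ((2 * D)⁻¹ * f t i * (if timer m β t = 1 then 1 else 0)) := by
    ext β e
    rw [explorationLoss, ite_and]
    split_ifs <;> ring
  have hf := hf0 t i
  calc expect T m ε (fun β e => explorationLoss D f m β e t i)
      = (2 * D)⁻¹ * f t i * (ℓ : ℝ)⁻¹ *
          expect T m ε (fun β (_ : ℕ → Fin ℓ) => if timer m β t = 1 then 1 else 0) := by
        rw [hloss, expect_explored_mul ht i fun _ _ _ _ => rfl, expect_const_mul]
        ring
    _ ≤ (2 * D)⁻¹ * f t i * (ℓ : ℝ)⁻¹ * ε :=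
        mul_le_mul_of_nonneg_left (expect_timer_eq_one_le hε0 hε1 ht) (by positivity)
    _ = (2 * D)⁻¹ * ((ℓ : ℝ)⁻¹ * (ε * f t i)) := by ring

theorem sum_expect_movedMass_le (hη : 0 ≤ η) :
    ∑ t ∈ Finset.range (T + 1), expect T m ε (movedMass D η f m t) ≤
      η * ∑ t ∈ Finset.range (T + 1), expect T m ε (meanLoss D η f m t) := by
  have hzero : expect T m ε (movedMass D η f m 0) = 0 := by
    simp only [expect, movedMass_zero, mul_zero, Finset.sum_const_zero]
  have hlast : 0 ≤ η * expect T m ε (meanLoss D η f m T) :=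
    mul_nonneg hη (expect_nonneg fun β e => meanLoss_nonneg hD hf0 T β e)
  rw [Finset.sum_range_succ', hzero, add_zero, Finset.sum_range_succ, mul_add, Finset.mul_sum]
  refine le_add_of_le_of_nonneg (Finset.sum_le_sum fun t _ => ?_) hlast
  rw [← expect_const_mul]
  exact expect_mono fun β e => movedMass_succ_le hD hf0 hη t β e

end nonneg

section bounded

variable (hD : 0 ≤ D) (hf0 : ∀ t j, 0 ≤ f t j) (hf1 : ∀ t j, f t j ≤ 2 * D)

include hD hf0 hf1

theorem sum_expect_meanLoss_le (hη : 0 ≤ η) (hε0 : 0 ≤ ε) (hε1 : ε ≤ 1) (i : Fin ℓ) :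
    (1 - Real.exp (-η)) * ∑ t ∈ Finset.range (T + 1), expect T m ε (meanLoss D η f m t) ≤
      η * ((2 * D)⁻¹ * ((ℓ : ℝ)⁻¹ * (ε * ∑ t ∈ Finset.range (T + 1), f t i))) + Real.log ℓ := by
  have hregret := expect_mono (T := T) (m := m) (ε := ε) fun β e =>
    hedge_regret (η := η) (explorationLoss_nonneg (m := m) hD hf0 β e)
      (explorationLoss_le_one hD hf1 β e) (T + 1) i
  rw [expect_const_mul, expect_sum, expect_add, expect_const_mul, expect_sum,
    expect_const hε0 hε1] at hregret
  refine hregret.trans (add_le_add_left (mul_le_mul_of_nonneg_left ?_ hη) _)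
  simp only [Finset.mul_sum]
  exact Finset.sum_le_sum fun t ht => expect_explorationLoss_le hD hf0 hε0 hε1
    (Nat.lt_succ_iff.1 (Finset.mem_range.1 ht)) i

theorem exp_neg_mul_coin_mul_meanCost_le (hη : 0 ≤ η) (hm : 1 ≤ m) (t : ℕ) (β : ℕ → Bool)
    (e : ℕ → Fin ℓ) :
    Real.exp (-η) * ((if β t then 1 else 0) *
        ((if timer m β t = 0 then 1 else 0) * meanCost D η f m t (t + m) β e)) ≤
      (if timer m β (t + m) = 1 then 1 else 0) * meanCost D η f m (t + m) (t + m) β e := by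
  rw [show (if timer m β (t + m) = 1 then (1 : ℝ) else 0) =
    (if β t then 1 else 0) * (if timer m β t = 0 then 1 else 0) by
      simp only [timer_add_eq_one_iff hm, ite_and]
      split_ifs <;> norm_num, ← mul_assoc, mul_left_comm]
  have hstable := exp_neg_mul_meanCost_le (m := m) hD hf0 hf1 hη β e (s := t) (s' := t + m)
    (by omega) (by omega) (t + m)
  split_ifs <;> linarith

-- The learner is replaced by the one at time `s`, which does not know the coin `β u`, and back.
theorem exp_neg_pow_four_mul_expect_coin_mul_meanCost_le (hη : 0 ≤ η) (hε0 : 0 ≤ ε) (hε1 : ε ≤ 1)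
    {t' u : ℕ} (huT : u ≤ T) (hsu : s ≤ u) (ht's : t' ≤ s + 2 * m) (hst' : s ≤ t' + 2 * m)
    (hts : t ≤ s + 2 * m) (hst : s ≤ t + 2 * m) :
    Real.exp (-η) ^ 4 *
        expect T m ε (fun β e => (if β u then 1 else 0) * meanCost D η f m t' t β e) ≤
      ε * expect T m ε (meanCost D η f m t t) := by
  set c := Real.exp (-η) ^ 2
  have hc : 0 ≤ c := by positivity
  calc Real.exp (-η) ^ 4 *
        expect T m ε (fun β e => (if β u then 1 else 0) * meanCost D η f m t' t β e)
      = c * expect T m ε (fun β e =>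
          (if β u then 1 else 0) * (c * meanCost D η f m t' t β e)) := by
        simp only [mul_left_comm _ c]
        rw [expect_const_mul, ← mul_assoc, ← pow_add]
    _ ≤ c * expect T m ε (fun β e => (if β u then 1 else 0) * meanCost D η f m s t β e) :=
        mul_le_mul_of_nonneg_left (expect_mono fun β e => mul_le_mul_of_nonneg_left
          (exp_neg_sq_mul_meanCost_le hD hf0 hf1 hη β e ht's hst' t)
          (by split_ifs <;> norm_num)) hc
    _ ≤ c * (ε * expect T m ε (meanCost D η f m s t)) :=
        mul_le_mul_of_nonneg_left (expect_coin_mul_le hε0 hε1 huT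
          (fun β e => meanCost_nonneg hf0 s t β e) fun β β' e h =>
            meanCost_congr (fun v hv => h v (by omega)) fun _ _ => rfl) hc
    _ = ε * expect T m ε (fun β e => c * meanCost D η f m s t β e) := by
        rw [expect_const_mul, mul_left_comm]
    _ ≤ ε * expect T m ε (meanCost D η f m t t) :=
        mul_le_mul_of_nonneg_left (expect_mono fun β e =>
          exp_neg_sq_mul_meanCost_le hD hf0 hf1 hη β e hst hts t) hε0

end bounded

section small

variable (hD : 0 ≤ D) (hf0 : ∀ t j, 0 ≤ f t j) (hf1 : ∀ t j, f t j ≤ 2 * D)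
  (hη : Real.exp (-η) = 1 - γ) (hγ0 : 0 ≤ γ) (hγ1 : γ ≤ 1 / 100) (hε0 : 0 ≤ ε) (hε1 : ε ≤ 1)

include hD hf0 hf1 hη hγ0 hγ1 hε0 hε1

theorem expect_coin_mul_meanCost_le {t' u : ℕ} (huT : u ≤ T) (hsu : s ≤ u)
    (ht's : t' ≤ s + 2 * m) (hst' : s ≤ t' + 2 * m) (hts : t ≤ s + 2 * m) (hst : s ≤ t + 2 * m) :
    expect T m ε (fun β e => (if β u then 1 else 0) * meanCost D η f m t' t β e) ≤
      11 / 10 * ε * expect T m ε (meanCost D η f m t t) := by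
  set P := expect T m ε fun β e => (if β u then 1 else 0) * meanCost D η f m t' t β e
  set Y := expect T m ε (meanCost D η f m t t)
  have hP : 0 ≤ P := expect_nonneg fun β e =>
    mul_nonneg (by split_ifs <;> norm_num) (meanCost_nonneg hf0 t' t β e)
  have hεY : 0 ≤ ε * Y := mul_nonneg hε0 (expect_nonneg fun β e => meanCost_nonneg hf0 t t β e)
  have hpow : 24 / 25 ≤ Real.exp (-η) ^ 4 := by
    have hbernoulli := one_add_mul_le_pow (show -2 ≤ -γ by linarith) 4
    rw [← sub_eq_add_neg 1 γ, ← hη] at hbernoulli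
    refine le_trans ?_ hbernoulli
    norm_num
    linarith
  have hle : Real.exp (-η) ^ 4 * P ≤ ε * Y :=
    exp_neg_pow_four_mul_expect_coin_mul_meanCost_le hD hf0 hf1 (nonneg_of_exp_neg_eq hη hγ0)
      hε0 hε1 huT hsu ht's hst' hts hst
  linarith [mul_le_mul_of_nonneg_right hpow hP]

theorem expect_timer_eq_zero_mul_meanCost_ge (hmε : m * ε ≤ γ) (htT : t + m ≤ T) :
    (1 - 3 * γ) * expect T m ε (meanCost D η f m (t + m) (t + m)) ≤ expect T m ε
      (fun β e => (if timer m β t = 0 then 1 else 0) * meanCost D η f m t (t + m) β e) := by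
  set Y := expect T m ε (meanCost D η f m (t + m) (t + m)) with hY
  have hY0 : 0 ≤ Y := expect_nonneg fun β e => meanCost_nonneg hf0 _ _ β e
  have hcoins : ∑ u ∈ Finset.Ico (t - m) t, expect T m ε
      (fun β e => (if β u then 1 else 0) * meanCost D η f m t (t + m) β e) ≤
      11 / 10 * (γ * Y) :=
    calc ∑ u ∈ Finset.Ico (t - m) t, expect T m ε
          (fun β e => (if β u then 1 else 0) * meanCost D η f m t (t + m) β e)
        ≤ (Finset.Ico (t - m) t).card • (11 / 10 * ε * Y) :=
          Finset.sum_le_card_nsmul _ _ _ fun u hu => by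
            rw [Finset.mem_Ico] at hu
            exact expect_coin_mul_meanCost_le hD hf0 hf1 hη hγ0 hγ1 hε0 hε1 (s := u) (by omega)
              le_rfl (by omega) (by omega) (by omega) (by omega)
      _ ≤ m * (11 / 10 * ε * Y) := by
          rw [Nat.card_Ico, nsmul_eq_mul]
          exact mul_le_mul_of_nonneg_right (Nat.cast_le.2 (by omega)) (by positivity)
      _ = 11 / 10 * (m * ε * Y) := by ring
      _ ≤ 11 / 10 * (γ * Y) := by gcongr
  have hstable : (1 - γ) * Y ≤ expect T m ε (meanCost D η f m t (t + m)) := by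
    rw [hY, ← hη, ← expect_const_mul]
    exact expect_mono fun β e => exp_neg_mul_meanCost_le hD hf0 hf1
      (nonneg_of_exp_neg_eq hη hγ0) β e (by omega) (by omega) _
  have htimer := expect_mono (T := T) (m := m) (ε := ε) fun β e => sub_sum_coin_mul_le
    (meanCost_nonneg (D := D) (η := η) (m := m) hf0 t (t + m) β e) m t β
  rw [expect_sub, expect_sum] at htimer
  linarith [mul_nonneg hγ0 hY0]

theorem expect_timer_eq_one_mul_meanCost_ge (hm : 1 ≤ m) (hmε : m * ε ≤ γ) (htm : m < t)
    (htT : t ≤ T) :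
    ε * (1 - 4 * γ) * expect T m ε (meanCost D η f m t t) ≤
      expect T m ε (fun β e => (if timer m β t = 1 then 1 else 0) * meanCost D η f m t t β e) := by
  obtain ⟨s, rfl⟩ : ∃ s, t = s + m := ⟨t - m, by omega⟩
  set Y := expect T m ε (meanCost D η f m (s + m) (s + m))
  have hY0 : 0 ≤ Y := expect_nonneg fun β e => meanCost_nonneg hf0 _ _ β e
  have hidle := expect_timer_eq_zero_mul_meanCost_ge hD hf0 hf1 hη hγ0 hγ1 hε0 hε1 hmε htT
  have hγ' : 1 - 4 * γ ≤ (1 - γ) * (1 - 3 * γ) := by nlinarith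
  calc ε * (1 - 4 * γ) * Y ≤ ε * ((1 - γ) * (1 - 3 * γ)) * Y := by gcongr
    _ = (1 - γ) * (ε * ((1 - 3 * γ) * Y)) := by ring
    _ ≤ (1 - γ) * (ε * expect T m ε (fun β e =>
          (if timer m β s = 0 then 1 else 0) * meanCost D η f m s (s + m) β e)) :=
        mul_le_mul_of_nonneg_left (mul_le_mul_of_nonneg_left hidle hε0) (by linarith)
    _ = expect T m ε (fun β e => Real.exp (-η) * ((if β s then 1 else 0) *
          ((if timer m β s = 0 then 1 else 0) * meanCost D η f m s (s + m) β e))) := by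
        rw [expect_const_mul, hη, expect_coin_mul hε0 hε1 (by omega) (by omega) fun β β' e h => by
          rw [timer_congr h, meanCost_congr h fun _ _ => rfl]]
    _ ≤ _ := expect_mono fun β e => exp_neg_mul_coin_mul_meanCost_le hD hf0 hf1
        (nonneg_of_exp_neg_eq hη hγ0) hm s β e

end small

end expected

section totals

variable {ℓ : ℕ} [NeZero ℓ] {D η ε γ : ℝ} {f : ℕ → Fin ℓ → ℝ} {m T t : ℕ}
  (hD : 0 < D) (hf0 : ∀ t j, 0 ≤ f t j) (hf1 : ∀ t j, f t j ≤ 2 * D)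
  (hη : Real.exp (-η) = 1 - γ) (hγ0 : 0 ≤ γ) (hγ1 : γ ≤ 1 / 100) (hε0 : 0 ≤ ε) (hε1 : ε ≤ 1)

include hD hf0 hf1 hη hγ0 hγ1 hε0 hε1

theorem mul_expect_meanCost_le (hm : 1 ≤ m) (hmε : m * ε ≤ γ) (htT : t ≤ T) :
    ε * (1 - 4 * γ) * expect T m ε (meanCost D η f m t t) ≤
      2 * D * ℓ * expect T m ε (meanLoss D η f m t) + if t < m + 1 then 2 * D * ε else 0 := by
  have hℓ : (ℓ : ℝ) ≠ 0 := Nat.cast_ne_zero.2 (NeZero.ne ℓ)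
  set E := expect T m ε
    (fun β e => (if timer m β t = 1 then 1 else 0) * meanCost D η f m t t β e) with hE
  have hloss : 2 * D * ℓ * expect T m ε (meanLoss D η f m t) = E := by
    rw [expect_meanLoss htT, ← hE]
    field_simp
  rw [hloss]
  split_ifs with htm
  · have hE0 : 0 ≤ E := expect_nonneg fun β e =>
      mul_nonneg (by split_ifs <;> norm_num) (meanCost_nonneg hf0 t t β e)
    have hle : expect T m ε (meanCost D η f m t t) ≤ 2 * D :=
      (expect_mono fun β e => meanCost_le hf1 t t β e).trans_eq (expect_const hε0 hε1 (2 * D))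
    calc ε * (1 - 4 * γ) * expect T m ε (meanCost D η f m t t)
        ≤ ε * 1 * (2 * D) := by
          have := expect_nonneg (T := T) (m := m) (ε := ε)
            (meanCost_nonneg (D := D) (η := η) (m := m) hf0 t t)
          gcongr
          linarith
      _ ≤ E + 2 * D * ε := by linarith
  · rw [add_zero]
    exact expect_timer_eq_one_mul_meanCost_ge hD.le hf0 hf1 hη hγ0 hγ1 hε0 hε1 hm hmε
      (by omega) htT

theorem sum_expect_meanCost_le (hm : 1 ≤ m) (hmε : m * ε ≤ γ) :
    ε * (1 - 4 * γ) * ∑ t ∈ Finset.range (T + 1), expect T m ε (meanCost D η f m t t) ≤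
      2 * D * ℓ * ∑ t ∈ Finset.range (T + 1), expect T m ε (meanLoss D η f m t) +
        4 * D * m * ε := by
  have hsum := Finset.sum_le_sum fun t (ht : t ∈ Finset.range (T + 1)) =>
    mul_expect_meanCost_le hD hf0 hf1 hη hγ0 hγ1 hε0 hε1 hm hmε
      (Nat.lt_succ_iff.1 (Finset.mem_range.1 ht))
  rw [Finset.sum_add_distrib, ← Finset.mul_sum, ← Finset.mul_sum] at hsum
  have hm' : (1 : ℝ) ≤ m := by exact_mod_cast hm
  have hcount : ∑ t ∈ Finset.range (T + 1), (if t < m + 1 then 2 * D * ε else 0) ≤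
      4 * D * m * ε :=
    calc ∑ t ∈ Finset.range (T + 1), (if t < m + 1 then 2 * D * ε else 0)
        ≤ (m + 1 : ℕ) * (2 * D * ε) := sum_range_ite_lt_le (by positivity) _ _
      _ ≤ (2 * m) * (2 * D * ε) := by
          push_cast
          gcongr
          linarith
      _ = 4 * D * m * ε := by ring
  linarith

theorem expect_coin_mul_meanBacklog_le {s : ℕ} (hs : s ∈ Finset.Ico (t - 2 * m) t)
    (htT : t ≤ T) :
    expect T m ε (fun β e => (if β s then 1 else 0) * (meanBacklog D η f m (t - 2 * m) β e +
        ∑ u ∈ Finset.Ioc (t - 2 * m) t, meanCost D η f m u u β e)) ≤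
      ε * expect T m ε (meanBacklog D η f m (t - 2 * m)) +
        11 / 10 * ε * ∑ u ∈ Finset.Ioc (t - 2 * m) t, expect T m ε (meanCost D η f m u u) := by
  rw [Finset.mem_Ico] at hs
  simp only [mul_add, expect_add, Finset.mul_sum, expect_sum]
  refine add_le_add ?_ (Finset.sum_le_sum fun u hu => ?_)
  · exact expect_coin_mul_le hε0 hε1 (by omega) (meanBacklog_nonneg hD.le hf0 _)
      fun β β' e h => meanBacklog_congr (fun u hu => h u (by omega)) fun _ _ => rfl
  · rw [Finset.mem_Ioc] at hu
    exact expect_coin_mul_meanCost_le hD.le hf0 hf1 hη hγ0 hγ1 hε0 hε1 (s := t - 2 * m)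
      (by omega) (by omega) (by omega) (by omega) (by omega) (by omega)

theorem expect_meanBacklog_le (htT : t ≤ T) :
    expect T m ε (meanBacklog D η f m t) ≤ (if t < m then m * (3 * D) else 0) +
      2 * m * ε * expect T m ε (meanBacklog D η f m (t - 2 * m)) +
      ∑ u ∈ Finset.Ioc (t - 2 * m) t, (11 / 5 * m * ε * expect T m ε (meanCost D η f m u u) +
        D * expect T m ε (movedMass D η f m u)) := by
  set V := expect T m ε (meanBacklog D η f m (t - 2 * m))
  set W := ∑ u ∈ Finset.Ioc (t - 2 * m) t, expect T m ε (meanCost D η f m u u)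
  have hV : 0 ≤ V := expect_nonneg (meanBacklog_nonneg hD.le hf0 _)
  have hW : 0 ≤ W := Finset.sum_nonneg fun u _ => expect_nonneg (meanCost_nonneg hf0 u u)
  have hcoins : ∑ s ∈ Finset.Ico (t - 2 * m) t, expect T m ε (fun β e => (if β s then 1 else 0) *
      (meanBacklog D η f m (t - 2 * m) β e +
        ∑ u ∈ Finset.Ioc (t - 2 * m) t, meanCost D η f m u u β e)) ≤
      2 * m * (ε * V + 11 / 10 * ε * W) := by
    have hcard : ((t - (t - 2 * m) : ℕ) : ℝ) ≤ 2 * m := by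
      exact_mod_cast (by omega : t - (t - 2 * m) ≤ 2 * m)
    refine (Finset.sum_le_card_nsmul _ _ _ fun s hs =>
      expect_coin_mul_meanBacklog_le hD hf0 hf1 hη hγ0 hγ1 hε0 hε1 hs htT).trans ?_
    rw [Nat.card_Ico, nsmul_eq_mul]
    exact mul_le_mul_of_nonneg_right hcard (by positivity)
  have hbacklog := expect_mono (T := T) (m := m) (ε := ε) (meanBacklog_le (η := η) (m := m)
    hD.le hf0 hf1 t)
  simp only [expect_add, expect_sum (Finset.Ico _ _), expect_sum (Finset.Ioc _ _),
    expect_const hε0 hε1, expect_const_mul D] at hbacklog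
  rw [Finset.sum_add_distrib, ← Finset.mul_sum]
  linarith

theorem sum_expect_meanBacklog_le (hmε : 2 * m * ε ≤ γ) :
    (1 - γ) * ∑ t ∈ Finset.range (T + 1), expect T m ε (meanBacklog D η f m t) ≤
      3 * D * m ^ 2 + 22 / 5 * m ^ 2 * ε *
        ∑ t ∈ Finset.range (T + 1), expect T m ε (meanCost D η f m t t) +
      2 * m * D * η * ∑ t ∈ Finset.range (T + 1), expect T m ε (meanLoss D η f m t) := by
  set S := ∑ t ∈ Finset.range (T + 1), expect T m ε (meanBacklog D η f m t)
  have hS : 0 ≤ S :=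
    Finset.sum_nonneg fun t _ => expect_nonneg (meanBacklog_nonneg hD.le hf0 t)
  have hzero : expect T m ε (meanBacklog D η f m 0) = 0 := by
    simp only [expect, meanBacklog, backlog, mul_zero, Finset.sum_const_zero]
  have hrec := one_sub_mul_sum_le_of_delayed_recursion (n := T + 1)
    (by positivity : 0 ≤ 2 * m * ε) hzero
    (fun t => expect_nonneg (meanBacklog_nonneg hD.le hf0 t))
    (fun u => add_nonneg
      (mul_nonneg (by positivity) (expect_nonneg (meanCost_nonneg hf0 u u)))
      (mul_nonneg hD.le (expect_nonneg (movedMass_nonneg u))))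
    fun t ht => expect_meanBacklog_le hD hf0 hf1 hη hγ0 hγ1 hε0 hε1 (Nat.lt_succ_iff.1 ht)
  rw [Finset.sum_add_distrib, ← Finset.mul_sum, ← Finset.mul_sum] at hrec
  push_cast at hrec
  have hinit := sum_range_ite_lt_le (by positivity : 0 ≤ m * (3 * D)) m (T + 1)
  have hmoved := mul_le_mul_of_nonneg_left (sum_expect_movedMass_le (T := T) (m := m) (ε := ε)
    hD.le hf0 (nonneg_of_exp_neg_eq hη hγ0)) (by positivity : 0 ≤ 2 * m * D)
  have hγS := mul_le_mul_of_nonneg_right hmε hS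
  linarith

end totals

/-! ### Balancing the bounds -/

section balance

variable {X G V S D η ε γ O m ℓ L : ℝ}

theorem two_mul_loss_le (hD : 0 < D) (hℓ : 0 < ℓ) (hO : 0 ≤ O) (hγ0 : 0 < γ) (hε : 0 ≤ ε)
    (hη : η ≤ γ * (1 + 2 * γ)) (hγ : D * ℓ * L = ε * (γ ^ 2 * O))
    (hG : γ * G ≤ η * ((2 * D)⁻¹ * (ℓ⁻¹ * (ε * O))) + L) :
    2 * D * ℓ * G ≤ ε * ((1 + 4 * γ) * O) := by
  refine le_of_mul_le_mul_left ?_ hγ0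
  calc γ * (2 * D * ℓ * G) = 2 * D * ℓ * (γ * G) := by ring
    _ ≤ 2 * D * ℓ * (η * ((2 * D)⁻¹ * (ℓ⁻¹ * (ε * O))) + L) := by gcongr
    _ = ε * (η * O) + 2 * (D * ℓ * L) := by field_simp
    _ = ε * (η * O + 2 * (γ ^ 2 * O)) := by rw [hγ]; ring
    _ ≤ ε * (γ * (1 + 2 * γ) * O + 2 * (γ ^ 2 * O)) := by gcongr
    _ = γ * (ε * ((1 + 4 * γ) * O)) := by ring

theorem cost_le_of_loss_le (hγ0 : 0 ≤ γ) (hγ1 : γ ≤ 1 / 100) (hO : 0 ≤ O) (hε : 0 < ε)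
    (hDm : D * m ≤ γ * O / 100) (hG : 2 * D * ℓ * G ≤ ε * ((1 + 4 * γ) * O))
    (hX : ε * (1 - 4 * γ) * X ≤ 2 * D * ℓ * G + 4 * D * m * ε) :
    X ≤ (1 + 10 * γ) * O := by
  have hX' : (1 - 4 * γ) * X ≤ (1 + 4 * γ) * O + 4 * (D * m) := by
    refine le_of_mul_le_mul_left ?_ hε
    linarith
  have hγγ : γ * (γ * O) ≤ 1 / 100 * (γ * O) :=
    mul_le_mul_of_nonneg_right hγ1 (mul_nonneg hγ0 hO)
  refine le_of_mul_le_mul_left (hX'.trans ?_) (by linarith : 0 < 1 - 4 * γ)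
  linarith [mul_nonneg hγ0 hO]

theorem switching_le_of_loss_le (hγ0 : 0 ≤ γ) (hγ1 : γ ≤ 1 / 100) (hO : 0 ≤ O) (hm : 1 ≤ m)
    (hℓ : 1 ≤ ℓ) (hD : 0 ≤ D) (hG0 : 0 ≤ G) (hη0 : 0 ≤ η) (hη : η ≤ γ * (1 + 2 * γ))
    (hε : 0 ≤ ε) (hγ : γ = m ^ 2 * ε) (hG : 2 * D * ℓ * G ≤ ε * ((1 + 4 * γ) * O)) :
    m * (D * (η * G)) ≤ γ * O / 50 := by
  have hmε : m * ε ≤ γ := by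
    rw [hγ, pow_two]
    exact mul_le_mul_of_nonneg_right (le_mul_of_one_le_left (by linarith) hm) hε
  have hηγ : η ≤ 2 * γ := hη.trans (by nlinarith)
  calc m * (D * (η * G)) ≤ ℓ * (m * (D * (η * G))) :=
        le_mul_of_one_le_left (by positivity) hℓ
    _ = m * η * (2 * D * ℓ * G) / 2 := by ring
    _ ≤ m * η * (ε * ((1 + 4 * γ) * O)) / 2 := by gcongr
    _ = m * ε * (η * ((1 + 4 * γ) * O)) / 2 := by ring
    _ ≤ 1 / 100 * (2 * γ * (2 * O)) / 2 := by
        gcongr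
        · exact hmε.trans hγ1
        · linarith
    _ = γ * O / 50 := by ring

theorem backlog_le_of_cost_le (hγ0 : 0 ≤ γ) (hγ1 : γ ≤ 1 / 100) (hO : 0 ≤ O)
    (hγ : γ = m ^ 2 * ε) (hDm : D * m ^ 2 ≤ γ * O / 100) (hX : X ≤ (1 + 10 * γ) * O)
    (hG : m * (D * (η * G)) ≤ γ * O / 50)
    (hV : (1 - γ) * V ≤ 3 * D * m ^ 2 + 22 / 5 * m ^ 2 * ε * X + 2 * m * D * η * G) :
    V ≤ 6 * (γ * O) := by
  have hγX : m ^ 2 * ε * X ≤ γ * ((1 + 10 * γ) * O) :=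
    hγ ▸ mul_le_mul_of_nonneg_left (hγ ▸ hX) (hγ ▸ hγ0)
  have hγγ : γ * (γ * O) ≤ 1 / 100 * (γ * O) :=
    mul_le_mul_of_nonneg_right hγ1 (mul_nonneg hγ0 hO)
  refine le_of_mul_le_mul_left ?_ (by linarith : 0 < 1 - γ)
  linarith [mul_nonneg hγ0 hO]

theorem cost_add_switching_add_backlog_le (hm : 1 ≤ m) (hℓ : 1 ≤ ℓ) (hℓL : 1 ≤ ℓ * L)
    (hD : 0 < D) (hO : 0 ≤ O) (hγ0 : 0 < γ) (hγ1 : γ ≤ 1 / 100) (hε : 0 < ε)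
    (hγε : γ = m ^ 2 * ε) (hγ : D * ℓ * L = ε * (γ ^ 2 * O))
    (hη0 : 0 ≤ η) (hη : η ≤ γ * (1 + 2 * γ)) (hG0 : 0 ≤ G)
    (hG : γ * G ≤ η * ((2 * D)⁻¹ * (ℓ⁻¹ * (ε * O))) + L)
    (hX : ε * (1 - 4 * γ) * X ≤ 2 * D * ℓ * G + 4 * D * m * ε) (hS : S ≤ η * G)
    (hV : (1 - γ) * V ≤ 3 * D * m ^ 2 + 22 / 5 * m ^ 2 * ε * X + 2 * m * D * η * G) :
    X + D * S + 2 * V ≤ O + 25 * (γ * O) := by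
  have hloss := two_mul_loss_le hD (by linarith) hO hγ0 hε.le hη hγ hG
  have hDm2 : D * m ^ 2 ≤ γ * O / 100 :=
    calc D * m ^ 2 ≤ D * m ^ 2 * (ℓ * L) := le_mul_of_one_le_right (by positivity) hℓL
      _ = m ^ 2 * (D * ℓ * L) := by ring
      _ = γ * (γ * (γ * O)) := by rw [hγ, ← mul_assoc, ← hγε]; ring
      _ ≤ 1 * (1 / 100 * (γ * O)) := by
          gcongr
          linarith
      _ = γ * O / 100 := by ring
  have hDm : D * m ≤ γ * O / 100 :=
    (mul_le_mul_of_nonneg_left (le_self_pow₀ hm two_ne_zero) hD.le).trans hDm2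
  have hcost := cost_le_of_loss_le hγ0.le hγ1 hO hε hDm hloss hX
  have hswitch := switching_le_of_loss_le hγ0.le hγ1 hO hm hℓ hD.le hG0 hη0 hη hε.le hγε hloss
  have hDS : D * S ≤ γ * O / 50 :=
    calc D * S ≤ D * (η * G) := by gcongr
      _ ≤ m * (D * (η * G)) := le_mul_of_one_le_left (by positivity) hm
      _ ≤ γ * O / 50 := hswitch
  have hbacklog := backlog_le_of_cost_le hγ0.le hγ1 hO hγε hDm2 hcost hswitch hV
  linarith [mul_nonneg hγ0.le hO]

end balance

/-! ### Runs of the algorithm -/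

section answers

variable {M : Type*} {ℓ : ℕ} {I : Instance M ℓ} {m : ℕ} {β : ℕ → Bool} {e i : ℕ → Fin ℓ} {t : ℕ}

theorem answer_eq_some {H : Fin ℓ → ℕ → M} {q : ℕ → Fin ℓ} {j : Fin ℓ} (hm : 2 ≤ m)
    (hmt : m ≤ t + 1) (hq : ∀ u ≤ t, t + 2 ≤ u + m → q u = j) :
    answer m H q t = some (H j t) := by
  have hqt : q t = j := hq t le_rfl (by omega)
  rw [answer, if_pos ⟨hmt, fun u hu hum => (hq u hu hum).trans hqt.symm⟩, hqt]

theorem query_eq_of_timer_eq_one (h : timer m β t = 1) {u : ℕ} (hut : u ≤ t) (htu : t < u + m) :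
    query m β e i u = e t := by
  have hu : timer m β u = t - u + 1 := by
    rw [← timer_sub_of_timer_eq_one h (k := t - u) (by omega), Nat.sub_sub_self hut]
  rw [query, hu, if_neg (Nat.succ_ne_zero _)]
  congr 1
  omega

theorem answers_eq_some_of_timer_eq_one (hm : 2 ≤ m) (h : timer m β t = 1) :
    I.answers m β e i (t - 1) = some (I.H (e t) (t - 1)) ∧
      I.answers m β e i t = some (I.H (e t) t) := by
  have hmt := le_of_timer_eq_one h
  exact ⟨answer_eq_some hm (by omega) fun u _ _ =>
      query_eq_of_timer_eq_one h (by omega) (by omega),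
    answer_eq_some hm (by omega) fun u _ _ => query_eq_of_timer_eq_one h (by omega) (by omega)⟩

theorem known_eq_none_or_eq_some (t : ℕ) :
    known (query m β e i) i (I.answers m β e i) t = none ∨
      known (query m β e i) i (I.answers m β e i) t = some (I.H (i t) t) := by
  rw [known, Instance.answers, answer]
  split_ifs with hq
  · exact Or.inr (by rw [hq])
  · exact Or.inl rfl
  · exact Or.inl rfl

theorem stale_of_known_eq_none (hm : 2 ≤ m) (hsw : ∀ t < I.T, i (t + 1) ≠ i t → timer m β t = 1)
    (ht : t ≤ I.T) (h : known (query m β e i) i (I.answers m β e i) t = none) : Stale m β t := by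
  by_contra hstale
  obtain ⟨hmt, htimer⟩ : m ≤ t + 1 ∧ ∀ u ≤ t, t + 2 ≤ u + m → timer m β u = 0 := by
    simpa only [Stale, not_or, not_lt, not_exists, not_and, not_not] using hstale
  have hconst : ∀ k ≤ t, k + 2 ≤ m → i (t - k) = i t := by
    intro k hkt hkm
    induction k with
    | zero => rfl
    | succ k ih =>
      rw [← ih (by omega) (by omega)]
      by_contra hne
      have hone := hsw (t - (k + 1)) (by omega)
        (by rwa [show t - (k + 1) + 1 = t - k by omega, ne_comm])
      have hzero := htimer (t - (k + 1)) (by omega) (by omega)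
      omega
  have hquery : ∀ u ≤ t, t + 2 ≤ u + m → query m β e i u = i t := fun u hu hum => by
    rw [query, if_pos (htimer u hu hum), ← hconst (t - u) (by omega) (by omega),
      Nat.sub_sub_self hu]
  rw [known, if_pos (hquery t le_rfl (by omega)), Instance.answers,
    answer_eq_some hm hmt hquery] at h
  exact Option.some_ne_none _ h

/-- The last known state `b_t` of an exploited heuristic in a run of the algorithm. -/
def Instance.lastState (I : Instance M ℓ) (m : ℕ) (β : ℕ → Bool) (e i : ℕ → Fin ℓ) : ℕ → M :=
  lastKnown I.s₀ (query m β e i) i (I.answers m β e i)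

/-- The state `s_t` of the algorithm in a run. -/
def Instance.state (I : Instance M ℓ) (greedy : ℕ → M → M) (m : ℕ) (β : ℕ → Bool)
    (e i : ℕ → Fin ℓ) : ℕ → M :=
  position I.s₀ greedy (query m β e i) i (I.answers m β e i)

theorem Instance.stale_or_state_succ_eq (greedy : ℕ → M → M) (hm : 2 ≤ m)
    (hsw : ∀ t < I.T, i (t + 1) ≠ i t → timer m β t = 1) (ht : t + 1 ≤ I.T) :
    (Stale m β (t + 1) ∧ I.lastState m β e i (t + 1) = I.lastState m β e i t ∧
        I.state greedy m β e i (t + 1) = greedy (t + 1) (I.lastState m β e i t)) ∨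
      (I.lastState m β e i (t + 1) = I.H (i (t + 1)) (t + 1) ∧
        I.state greedy m β e i (t + 1) = I.H (i (t + 1)) (t + 1)) := by
  simp only [Instance.lastState, Instance.state, lastKnown, position]
  rcases known_eq_none_or_eq_some (I := I) (m := m) (β := β) (e := e) (i := i) (t + 1) with h | h
  · rw [h]
    exact Or.inl ⟨stale_of_known_eq_none hm hsw ht h, rfl, rfl⟩
  · rw [h]
    exact Or.inr ⟨rfl, rfl⟩

end answers

section run

variable {M : Type*} [MetricSpace M] {ℓ : ℕ} (I : Instance M ℓ)

/-- The costs of the heuristics as real numbers, extended by zero to all times. -/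
def Instance.realCost (t : ℕ) (j : Fin ℓ) : ℝ :=
  if t ∈ Finset.Icc 1 I.T then (I.f t j).toReal else 0

theorem Instance.realCost_nonneg (t : ℕ) (j : Fin ℓ) : 0 ≤ I.realCost t j := by
  rw [Instance.realCost]
  split_ifs
  exacts [ENNReal.toReal_nonneg, le_rfl]

variable {I}

theorem Instance.realCost_le {D : ℝ} (hD : 0 ≤ D)
    (hf : ∀ t ∈ Finset.Icc 1 I.T, ∀ i, I.f t i ≤ ENNReal.ofReal (2 * D)) (t : ℕ) (j : Fin ℓ) :
    I.realCost t j ≤ 2 * D := by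
  rw [Instance.realCost]
  split_ifs with h
  · exact ENNReal.toReal_le_of_le_ofReal (by linarith) (hf t h j)
  · linarith

theorem Instance.f_eq_ofReal_realCost {D : ℝ}
    (hf : ∀ t ∈ Finset.Icc 1 I.T, ∀ i, I.f t i ≤ ENNReal.ofReal (2 * D)) {t : ℕ}
    (ht : t ∈ Finset.Icc 1 I.T) (j : Fin ℓ) : I.f t j = ENNReal.ofReal (I.realCost t j) := by
  rw [Instance.realCost, if_pos ht,
    ENNReal.ofReal_toReal (ne_top_of_le_ne_top ENNReal.ofReal_ne_top (hf t ht j))]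

theorem Instance.loss_eq_explorationLoss {D : ℝ} {m : ℕ} (hm : 2 ≤ m) {β : ℕ → Bool}
    {e i : ℕ → Fin ℓ} {t : ℕ} (ht : t ≤ I.T) :
    loss D I.c (timer m β) (query m β e i) (I.answers m β e i) t =
      explorationLoss D I.realCost m β e t := by
  ext j
  by_cases h : timer m β t = 1
  · have hmt := le_of_timer_eq_one h
    obtain ⟨hprev, hcur⟩ := answers_eq_some_of_timer_eq_one (I := I) (e := e) (i := i) hm h
    rw [loss, explorationLoss, hprev, hcur, query_eq_of_timer_eq_one h le_rfl (by omega)]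
    by_cases hj : j = e t
    · rw [if_pos ⟨h, hj⟩, if_pos ⟨h, hj⟩, Instance.realCost,
        if_pos (Finset.mem_Icc.2 ⟨by omega, ht⟩), hj]
      rfl
    · rw [if_neg fun h' => hj h'.2, if_neg fun h' => hj h'.2]
  · rw [loss, if_neg fun h' => h h'.1, explorationLoss_eq_zero h]

theorem Instance.dist_eq_learned {D η : ℝ} {m : ℕ} (hm : 2 ≤ m) {β : ℕ → Bool}
    {e i : ℕ → Fin ℓ} {t : ℕ} (ht : t ≤ I.T) :
    I.dist D m η β e i t = learned D η I.realCost m β e t :=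
  hedge_congr fun _ hu => loss_eq_explorationLoss hm (hu.le.trans ht)

variable (I) in
/-- The cost of the exploited heuristic at time `t`, where a switch is charged the diameter
`D`. -/
def Instance.followCost (D : ℝ) (i : ℕ → Fin ℓ) (t : ℕ) : ℝ :=
  I.realCost t (i t) + D * if i t ≠ i (t - 1) then 1 else 0

variable {D : ℝ} {m : ℕ} {β : ℕ → Bool} {e i : ℕ → Fin ℓ} {greedy : ℕ → M → M}

theorem Instance.followCost_nonneg (hD : 0 ≤ D) (t : ℕ) : 0 ≤ I.followCost D i t :=
  add_nonneg (I.realCost_nonneg _ _) (mul_nonneg hD (by split_ifs <;> norm_num))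

theorem Instance.backlog_followCost_nonneg (hD : 0 ≤ D) (t : ℕ) :
    0 ≤ backlog m β (I.followCost D i) t :=
  backlog_nonneg (fun _ => followCost_nonneg hD _) t

section cost

variable (hdiam : ∀ a b : M, edist a b ≤ ENNReal.ofReal D) (hD : 0 ≤ D)
  (hf : ∀ t ∈ Finset.Icc 1 I.T, ∀ i, I.f t i ≤ ENNReal.ofReal (2 * D))
  (hgreedy : IsGreedy I greedy) (hm : 2 ≤ m)
  (hsw : ∀ t < I.T, i (t + 1) ≠ i t → timer m β t = 1)

include hdiam hD hf

theorem Instance.edist_add_c_le_followCost {t : ℕ} (ht : t + 1 ≤ I.T) :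
    edist (I.H (i t) t) (I.H (i (t + 1)) (t + 1)) + I.c (t + 1) (I.H (i (t + 1)) (t + 1)) ≤
      ENNReal.ofReal (I.followCost D i (t + 1)) := by
  have hswitch : edist (I.H (i t) t) (I.H (i (t + 1)) t) ≤
      ENNReal.ofReal (D * if i (t + 1) ≠ i t then 1 else 0) := by
    by_cases h : i (t + 1) = i t
    · rw [h, edist_self]
      exact zero_le
    · rw [if_pos h, mul_one]
      exact hdiam _ _
  have hstep : edist (I.H (i (t + 1)) t) (I.H (i (t + 1)) (t + 1)) +
      I.c (t + 1) (I.H (i (t + 1)) (t + 1)) =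
      ENNReal.ofReal (I.realCost (t + 1) (i (t + 1))) := by
    rw [← f_eq_ofReal_realCost hf (Finset.mem_Icc.2 ⟨by omega, ht⟩), Instance.f, add_comm,
      Nat.add_sub_cancel]
  calc _ ≤ edist (I.H (i t) t) (I.H (i (t + 1)) t) +
        edist (I.H (i (t + 1)) t) (I.H (i (t + 1)) (t + 1)) +
        I.c (t + 1) (I.H (i (t + 1)) (t + 1)) := by gcongr; exact edist_triangle _ _ _
    _ ≤ ENNReal.ofReal (D * if i (t + 1) ≠ i t then 1 else 0) +
        ENNReal.ofReal (I.realCost (t + 1) (i (t + 1))) := by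
      rw [add_assoc, hstep]
      gcongr
    _ = ENNReal.ofReal (I.followCost D i (t + 1)) := by
      rw [← ENNReal.ofReal_add (mul_nonneg hD (by split_ifs <;> norm_num))
        (I.realCost_nonneg _ _), Instance.followCost, Nat.add_sub_cancel, add_comm]

theorem Instance.edist_add_c_le_of_edist_le {t : ℕ} (ht : t + 1 ≤ I.T) {b : M} {r : ℝ≥0∞}
    (hb : edist b (I.H (i t) t) ≤ r) :
    edist b (I.H (i (t + 1)) (t + 1)) + I.c (t + 1) (I.H (i (t + 1)) (t + 1)) ≤
      r + ENNReal.ofReal (I.followCost D i (t + 1)) :=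
  calc _ ≤ edist b (I.H (i t) t) + edist (I.H (i t) t) (I.H (i (t + 1)) (t + 1)) +
        I.c (t + 1) (I.H (i (t + 1)) (t + 1)) := by gcongr; exact edist_triangle _ _ _
    _ ≤ r + ENNReal.ofReal (I.followCost D i (t + 1)) := by
      rw [add_assoc]
      exact add_le_add hb (edist_add_c_le_followCost hdiam hD hf ht)

include hm hsw

theorem Instance.edist_lastState_le {t : ℕ} (ht : t ≤ I.T) :
    edist (I.lastState m β e i t) (I.H (i t) t) ≤
      ENNReal.ofReal (backlog m β (I.followCost D i) t) := by
  induction t with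
  | zero =>
    rw [Instance.lastState, lastKnown, I.H_zero, edist_self]
    exact zero_le
  | succ t ih =>
    rcases stale_or_state_succ_eq (e := e) (fun _ => id) hm hsw ht with
      ⟨hstale, hlast, -⟩ | ⟨hlast, -⟩
    · rw [hlast, backlog, if_pos hstale,
        ENNReal.ofReal_add (backlog_followCost_nonneg hD t) (followCost_nonneg hD _)]
      exact le_self_add.trans (edist_add_c_le_of_edist_le hdiam hD hf ht (ih (by omega)))
    · rw [hlast, edist_self]
      exact zero_le

include hgreedy

theorem Instance.edist_lastState_add_c_le {t : ℕ} (ht : t + 1 ≤ I.T) :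
    edist (I.lastState m β e i t) (I.state greedy m β e i (t + 1)) +
        I.c (t + 1) (I.state greedy m β e i (t + 1)) ≤
      ENNReal.ofReal (backlog m β (I.followCost D i) t) +
        ENNReal.ofReal (I.followCost D i (t + 1)) := by
  refine le_trans ?_ (edist_add_c_le_of_edist_le hdiam hD hf ht
    (edist_lastState_le (e := e) hdiam hD hf hm hsw (Nat.le_of_succ_le ht)))
  rcases stale_or_state_succ_eq (e := e) greedy hm hsw ht with ⟨-, -, hstate⟩ | ⟨-, hstate⟩
  · rw [hstate]
    exact hgreedy _ (Finset.mem_Icc.2 ⟨by omega, ht⟩) _ _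
  · rw [hstate]

theorem Instance.edist_state_lastState_le {t : ℕ} (ht : t ≤ I.T) :
    edist (I.state greedy m β e i t) (I.lastState m β e i t) ≤
      ENNReal.ofReal (backlog m β (I.followCost D i) t) := by
  cases t with
  | zero =>
    rw [Instance.state, Instance.lastState, position, lastKnown, edist_self]
    exact zero_le
  | succ t =>
    rcases stale_or_state_succ_eq (e := e) greedy hm hsw ht with
      ⟨hstale, hlast, -⟩ | ⟨hlast, hstate⟩
    · rw [hlast, edist_comm, backlog, if_pos hstale,
        ENNReal.ofReal_add (backlog_followCost_nonneg hD t) (followCost_nonneg hD _)]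
      exact le_self_add.trans (edist_lastState_add_c_le hdiam hD hf hgreedy hm hsw ht)
    · rw [hlast, hstate, edist_self]
      exact zero_le

theorem Instance.c_add_edist_state_le {t : ℕ} (ht : t + 1 ≤ I.T) :
    I.c (t + 1) (I.state greedy m β e i (t + 1)) +
        edist (I.state greedy m β e i t) (I.state greedy m β e i (t + 1)) ≤
      ENNReal.ofReal (I.followCost D i (t + 1) + 2 * backlog m β (I.followCost D i) t) := by
  have hF := followCost_nonneg (I := I) (i := i) hD (t + 1)
  have hV := backlog_followCost_nonneg (I := I) (m := m) (β := β) (i := i) hD t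
  calc _ ≤ I.c (t + 1) (I.state greedy m β e i (t + 1)) +
        (edist (I.state greedy m β e i t) (I.lastState m β e i t) +
          edist (I.lastState m β e i t) (I.state greedy m β e i (t + 1))) := by
        gcongr; exact edist_triangle _ _ _
    _ = edist (I.state greedy m β e i t) (I.lastState m β e i t) +
        (edist (I.lastState m β e i t) (I.state greedy m β e i (t + 1)) +
          I.c (t + 1) (I.state greedy m β e i (t + 1))) := by ring
    _ ≤ ENNReal.ofReal (backlog m β (I.followCost D i) t) +
        (ENNReal.ofReal (backlog m β (I.followCost D i) t) +
          ENNReal.ofReal (I.followCost D i (t + 1))) :=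
      add_le_add (edist_state_lastState_le hdiam hD hf hgreedy hm hsw (Nat.le_of_succ_le ht))
        (edist_lastState_add_c_le hdiam hD hf hgreedy hm hsw ht)
    _ = ENNReal.ofReal (I.followCost D i (t + 1) + 2 * backlog m β (I.followCost D i) t) := by
      rw [← ENNReal.ofReal_add hV hF, ← ENNReal.ofReal_add hV (add_nonneg hV hF)]
      congr 1
      ring

theorem Instance.cost_le :
    I.cost greedy m β e i ≤ ENNReal.ofReal (∑ t ∈ Finset.range (I.T + 1),
      (I.followCost D i t + 2 * backlog m β (I.followCost D i) t)) := by
  have hF := fun t => followCost_nonneg (I := I) (i := i) hD t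
  have hV := fun t => backlog_followCost_nonneg (I := I) (m := m) (β := β) (i := i) hD t
  have hcost : I.cost greedy m β e i = ∑ t ∈ Finset.range I.T,
      (I.c (t + 1) (I.state greedy m β e i (t + 1)) +
        edist (I.state greedy m β e i t) (I.state greedy m β e i (t + 1))) := by
    rw [Finset.range_eq_Ico]
    exact (Finset.sum_Ico_add' (fun t => I.c t (I.state greedy m β e i t) +
      edist (I.state greedy m β e i (t - 1)) (I.state greedy m β e i t)) 0 I.T 1).symm
  rw [hcost]
  refine (Finset.sum_le_sum fun t ht => c_add_edist_state_le hdiam hD hf hgreedy hm hsw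
    (Finset.mem_range.1 ht)).trans ?_
  rw [← ENNReal.ofReal_sum_of_nonneg fun t _ => add_nonneg (hF _) (mul_nonneg zero_le_two (hV t))]
  refine ENNReal.ofReal_le_ofReal ?_
  rw [Finset.sum_add_distrib, Finset.sum_add_distrib, Finset.sum_range_succ' (I.followCost D i),
    Finset.sum_range_succ fun t => 2 * backlog m β (I.followCost D i) t]
  linarith [hF 0, hV I.T]

end cost

end run

/-! ### The expected cost of the algorithm -/

section total

variable {ℓ m T : ℕ} {R : (Fin ℓ → ℝ) → (Fin ℓ → ℝ) → Fin ℓ → PMF (Fin ℓ)}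

theorem pathExpect_backlog {x : ℕ → Fin ℓ → ℝ} {β : ℕ → Bool} {F : (ℕ → Fin ℓ) → ℕ → ℝ}
    {F' : ℕ → ℝ} (hF : ∀ t ≤ T, pathExpect R T x (fun i => F i t) = F' t) {t : ℕ} (ht : t ≤ T) :
    pathExpect R T x (fun i => backlog m β (F i) t) = backlog m β F' t := by
  have hzero : pathExpect R T x (fun _ => 0) = 0 := by
    simp only [pathExpect, mul_zero, Finset.sum_const_zero]
  induction t with
  | zero => exact hzero
  | succ t ih =>
    by_cases h : Stale m β (t + 1)
    · simp only [backlog, if_pos h]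
      rw [pathExpect_add, ih (by omega), hF _ ht]
    · simpa only [backlog, if_neg h] using hzero

theorem learned_mem_stdSimplex [NeZero ℓ] {D η : ℝ} (f : ℕ → Fin ℓ → ℝ) (β : ℕ → Bool)
    (e : ℕ → Fin ℓ) (t : ℕ) : learned D η f m β e t ∈ stdSimplex ℝ (Fin ℓ) :=
  hedge_mem_stdSimplex _ _ _

theorem learned_zero {D η : ℝ} (f : ℕ → Fin ℓ → ℝ) (β : ℕ → Bool) (e : ℕ → Fin ℓ) (j : Fin ℓ) :
    learned D η f m β e 0 j = (ℓ : ℝ)⁻¹ :=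
  hedge_zero _ _ _

theorem ofReal_expect_pathExpect [NeZero ℓ] {ε : ℝ}
    {x : (ℕ → Bool) → (ℕ → Fin ℓ) → ℕ → Fin ℓ → ℝ}
    {G : (ℕ → Bool) → (ℕ → Fin ℓ) → (ℕ → Fin ℓ) → ℝ} (hG : ∀ β e i, 0 ≤ G β e i) :
    ENNReal.ofReal (expect T m ε fun β e => pathExpect R T (x β e) (G β e)) =
      ∑ β : Fin (T + 1) → Bool, ∑ e : Fin (T + m + 1) → Fin ℓ, ∑ i : Fin (T + 1) → Fin ℓ,
        coinProb T ε (ext β) * ((ℓ : ℝ≥0∞)⁻¹) ^ (T + m + 1) *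
          pathProb R T (x (ext β) (ext e)) (ext i) *
          ENNReal.ofReal (G (ext β) (ext e) (ext i)) := by
  have hpath : ∀ β e, 0 ≤ pathExpect R T (x β e) (G β e) := fun β e =>
    Finset.sum_nonneg fun i _ => mul_nonneg ENNReal.toReal_nonneg (hG β e _)
  have hweight : ((ℓ : ℝ≥0∞)⁻¹) ^ (T + m + 1) = ENNReal.ofReal ((ℓ : ℝ)⁻¹ ^ (T + m + 1)) := by
    rw [ENNReal.ofReal_pow (by positivity),
      ENNReal.ofReal_inv_of_pos (Nat.cast_pos.2 (NeZero.pos ℓ)), ENNReal.ofReal_natCast]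
  have hterm : ∀ β e, 0 ≤ (coinProb T ε β).toReal * (ℓ : ℝ)⁻¹ ^ (T + m + 1) *
      pathExpect R T (x β e) (G β e) := fun β e => mul_nonneg (by positivity) (hpath β e)
  rw [expect, ENNReal.ofReal_sum_of_nonneg fun β _ => Finset.sum_nonneg fun e _ => hterm _ _]
  refine Finset.sum_congr rfl fun β _ => ?_
  rw [ENNReal.ofReal_sum_of_nonneg fun e _ => hterm _ _]
  refine Finset.sum_congr rfl fun e _ => ?_
  rw [ENNReal.ofReal_mul (by positivity), ENNReal.ofReal_mul (by positivity), ← hweight,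
    ENNReal.ofReal_toReal (coinProb_ne_top _ _ _), pathExpect,
    ENNReal.ofReal_sum_of_nonneg fun i _ => mul_nonneg ENNReal.toReal_nonneg (hG _ _ _),
    Finset.mul_sum]
  refine Finset.sum_congr rfl fun i _ => ?_
  rw [ENNReal.ofReal_mul ENNReal.toReal_nonneg, ENNReal.ofReal_toReal (pathProb_ne_top _ _ _ _),
    mul_assoc _ (pathProb _ _ _ _)]

variable {M : Type*} [MetricSpace M] {I : Instance M ℓ} {greedy : ℕ → M → M} {D η : ℝ}

theorem Instance.pathExpect_followCost [NeZero ℓ] (hR : IsRound R) (β : ℕ → Bool)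
    (e : ℕ → Fin ℓ) {t : ℕ} (ht : t ≤ I.T) :
    pathExpect R I.T (learned D η I.realCost m β e) (fun i => I.followCost D i t) =
      meanStep D η I.realCost m t β e := by
  have hswitch : pathExpect R I.T (learned D η I.realCost m β e)
      (fun i => if i t ≠ i (t - 1) then 1 else 0) = movedMass D η I.realCost m t β e := by
    cases t with
    | zero => simp [pathExpect, movedMass_zero]
    | succ t =>
      exact pathExpect_switch hR (learned_mem_stdSimplex _ β e) (learned_pos β e)
        (learned_zero _ β e) ht
  simp only [Instance.followCost]
  rw [pathExpect_add, pathExpect_const_mul, hswitch,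
    pathExpect_apply hR (learned_mem_stdSimplex _ β e) (learned_pos β e)
      (learned_zero _ β e) (I.realCost t) ht]
  rfl

theorem Instance.pathExpect_sum_followCost [NeZero ℓ] (hR : IsRound R) (β : ℕ → Bool)
    (e : ℕ → Fin ℓ) :
    pathExpect R I.T (learned D η I.realCost m β e) (fun i => ∑ t ∈ Finset.range (I.T + 1),
        (I.followCost D i t + 2 * backlog m β (I.followCost D i) t)) =
      ∑ t ∈ Finset.range (I.T + 1),
        (meanStep D η I.realCost m t β e + 2 * meanBacklog D η I.realCost m t β e) := by
  rw [pathExpect_sum]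
  refine Finset.sum_congr rfl fun t ht => ?_
  have htT := Nat.lt_succ_iff.1 (Finset.mem_range.1 ht)
  rw [pathExpect_add, pathExpect_const_mul, pathExpect_followCost hR β e htT,
    pathExpect_backlog (fun u hu => pathExpect_followCost hR β e hu) htT, meanBacklog]

section bound

variable (hdiam : ∀ a b : M, edist a b ≤ ENNReal.ofReal D) (hD : 0 ≤ D)
  (hf : ∀ t ∈ Finset.Icc 1 I.T, ∀ i, I.f t i ≤ ENNReal.ofReal (2 * D))
  (hgreedy : IsGreedy I greedy) (hm : 2 ≤ m)

include hdiam hD hf hgreedy hm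

theorem Instance.pathProb_mul_cost_le (β : ℕ → Bool) (e i : ℕ → Fin ℓ) :
    pathProb R I.T (learned D η I.realCost m β e) i * I.cost greedy m β e i ≤
      pathProb R I.T (learned D η I.realCost m β e) i *
        ENNReal.ofReal (∑ t ∈ Finset.range (I.T + 1),
          (I.followCost D i t + 2 * backlog m β (I.followCost D i) t)) := by
  by_cases hzero : pathProb R I.T (learned D η I.realCost m β e) i = 0
  · rw [hzero, zero_mul, zero_mul]
  · have hsw : ∀ t < I.T, i (t + 1) ≠ i t → timer m β t = 1 := fun t ht hne =>
      of_not_not fun htimer => hne (eq_of_pathProb_ne_zero hzero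
        (Finset.mem_Icc.2 ⟨by omega, ht⟩) (learned_succ_of_timer_ne_one htimer))
    gcongr
    exact cost_le hdiam hD hf hgreedy hm hsw

theorem Instance.expectedCost_le_ofReal_expect [NeZero ℓ] (hR : IsRound R) (ε : ℝ) :
    I.expectedCost greedy R D m ε η ≤ ENNReal.ofReal (expect I.T m ε fun β e =>
      ∑ t ∈ Finset.range (I.T + 1),
        (meanStep D η I.realCost m t β e + 2 * meanBacklog D η I.realCost m t β e)) := by
  simp only [← pathExpect_sum_followCost hR]
  rw [ofReal_expect_pathExpect fun β e i => Finset.sum_nonneg fun t _ =>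
    add_nonneg (followCost_nonneg hD t) (mul_nonneg zero_le_two (backlog_followCost_nonneg hD t)),
    Instance.expectedCost]
  refine Finset.sum_le_sum fun β _ => Finset.sum_le_sum fun e _ => Finset.sum_le_sum fun i _ => ?_
  rw [pathProb_congr fun t ht => dist_eq_learned hm ht, mul_assoc, mul_assoc _ (pathProb _ _ _ _)]
  exact mul_le_mul_right (pathProb_mul_cost_le hdiam hD hf hgreedy hm _ _ _) _

end bound

end total

/-! ### Choice of the parameters -/

section params

variable {D OPT γ : ℝ} {ℓ m : ℕ}

theorem gammaParam_eq_sq_mul_epsParam (hm : 0 < m) :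
    gammaParam D ℓ m OPT = (m : ℝ) ^ 2 * epsParam D ℓ m OPT := by
  have hpow : (m : ℝ) ^ (2 / 3 : ℝ) = (m : ℝ) ^ 2 * (m : ℝ) ^ (-4 / 3 : ℝ) := by
    rw [← Real.rpow_natCast, ← Real.rpow_add (Nat.cast_pos.2 hm)]
    norm_num
  rw [gammaParam, epsParam, hpow]
  ring

theorem gammaParam_mul_opt (hO : 0 < OPT) :
    gammaParam D ℓ m OPT * OPT =
      (D * ℓ * Real.log ℓ) ^ (1 / 3 : ℝ) * (m : ℝ) ^ (2 / 3 : ℝ) * OPT ^ (2 / 3 : ℝ) := by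
  have hpow : OPT ^ (-1 / 3 : ℝ) * OPT = OPT ^ (2 / 3 : ℝ) := by
    nth_rewrite 2 [← Real.rpow_one OPT]
    rw [← Real.rpow_add hO]
    norm_num
  rw [gammaParam, mul_assoc, hpow]

theorem rpow_pow_three {y : ℝ} (hy : 0 ≤ y) (a : ℝ) : (y ^ a) ^ 3 = y ^ (a * 3) := by
  rw [Real.rpow_mul hy, ← Real.rpow_natCast (y ^ a), Nat.cast_ofNat]

theorem gammaParam_pow_three_mul (ha : 0 ≤ D * ℓ * Real.log ℓ) (hO : 0 < OPT) :
    gammaParam D ℓ m OPT ^ 3 * OPT = D * ℓ * Real.log ℓ * (m : ℝ) ^ 2 := by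
  rw [gammaParam, mul_pow, mul_pow, rpow_pow_three ha, rpow_pow_three (Nat.cast_nonneg m),
    rpow_pow_three hO.le]
  norm_num [Real.rpow_neg_one, mul_assoc, hO.ne']

theorem epsParam_mul_gammaParam_sq_mul (hm : 0 < m) (ha : 0 ≤ D * ℓ * Real.log ℓ) (hO : 0 < OPT) :
    epsParam D ℓ m OPT * (gammaParam D ℓ m OPT ^ 2 * OPT) = D * ℓ * Real.log ℓ := by
  have hm' : (0 : ℝ) < (m : ℝ) ^ 2 := pow_pos (Nat.cast_pos.2 hm) 2
  refine mul_left_cancel₀ hm'.ne' ?_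
  rw [← mul_assoc, ← gammaParam_eq_sq_mul_epsParam hm, ← mul_assoc, ← pow_succ',
    gammaParam_pow_three_mul ha hO, mul_comm]

theorem gammaParam_le (ha : 0 ≤ D * ℓ * Real.log ℓ) (hO : 0 < OPT)
    (h : 10 ^ 6 * (D * ℓ * Real.log ℓ * (m : ℝ) ^ 2) ≤ OPT) :
    gammaParam D ℓ m OPT ≤ 1 / 100 := by
  refine le_of_pow_le_pow_left₀ three_ne_zero (by norm_num) (le_of_mul_le_mul_right ?_ hO)
  rw [gammaParam_pow_three_mul ha hO]
  linarith

theorem neg_log_one_sub_le (hγ0 : 0 ≤ γ) (hγ1 : γ ≤ 1 / 2) :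
    -Real.log (1 - γ) ≤ γ * (1 + 2 * γ) := by
  have hpos : 0 < 1 - γ := by linarith
  have hinv : (1 - γ)⁻¹ ≤ 1 + γ * (1 + 2 * γ) := by
    rw [inv_le_iff_one_le_mul₀ hpos]
    linarith [mul_nonneg (mul_nonneg hγ0 hγ0) (sub_nonneg.2 hγ1)]
  linarith [Real.one_sub_inv_le_log_of_pos hpos]

theorem one_le_mul_log (hℓ : 2 ≤ ℓ) : 1 ≤ ℓ * Real.log ℓ := by
  have hℓ' : (2 : ℝ) ≤ ℓ := by exact_mod_cast hℓ
  calc (1 : ℝ) ≤ ℓ * (1 - (ℓ : ℝ)⁻¹) := by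
        rw [mul_sub, mul_inv_cancel₀ (by positivity)]
        linarith
    _ ≤ ℓ * Real.log ℓ := by
        gcongr
        exact Real.one_sub_inv_le_log_of_pos (by positivity)

theorem mul_log_mul_sq_le_of_mul_le_rpow {D₀ : ℝ} (hD₀ : 0 < D₀) (hD : D₀ ≤ D) (hO : 0 ≤ OPT)
    (h : D * ℓ * m ≤ D₀ ^ (2 / 3 : ℝ) / 100 * OPT ^ (1 / 3 : ℝ)) :
    10 ^ 6 * (D * ℓ * Real.log ℓ * (m : ℝ) ^ 2) ≤ OPT := by
  have hDpos : 0 < D := hD₀.trans_le hD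
  have hsq : ((ℓ : ℝ) * m) ^ 2 ≤ (ℓ * m) ^ 3 := by
    rcases (ℓ * m).eq_zero_or_pos with hzero | hpos
    · rw [← Nat.cast_mul, hzero, Nat.cast_zero, zero_pow two_ne_zero, zero_pow three_ne_zero]
    · exact_mod_cast Nat.pow_le_pow_right hpos (by norm_num : 2 ≤ 3)
  have hcube : (D * ℓ * m) ^ 3 ≤ D₀ ^ 2 / 10 ^ 6 * OPT := by
    refine (pow_le_pow_left₀ (by positivity) h 3).trans_eq ?_
    rw [mul_pow, div_pow, rpow_pow_three hD₀.le, rpow_pow_three hO]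
    norm_num
  refine le_of_mul_le_mul_left ?_ (pow_pos hDpos 2)
  calc D ^ 2 * (10 ^ 6 * (D * ℓ * Real.log ℓ * (m : ℝ) ^ 2))
      ≤ D ^ 2 * (10 ^ 6 * (D * ℓ * ℓ * (m : ℝ) ^ 2)) := by
        gcongr
        exact Real.log_le_self (Nat.cast_nonneg ℓ)
    _ = 10 ^ 6 * (D ^ 3 * (ℓ * m) ^ 2) := by ring
    _ ≤ 10 ^ 6 * (D ^ 3 * (ℓ * m) ^ 3) := by gcongr
    _ = 10 ^ 6 * (D * ℓ * m) ^ 3 := by ring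
    _ ≤ 10 ^ 6 * (D₀ ^ 2 / 10 ^ 6 * OPT) := by gcongr
    _ = D₀ ^ 2 * OPT := by ring
    _ ≤ D ^ 2 * OPT := by gcongr

end params

section main

variable {M : Type*} [MetricSpace M] {ℓ m : ℕ} {I : Instance M ℓ} {D ε γ : ℝ}
  {R : (Fin ℓ → ℝ) → (Fin ℓ → ℝ) → Fin ℓ → PMF (Fin ℓ)} {greedy : ℕ → M → M}

theorem Instance.exists_opt_eq_ofReal [NeZero ℓ]
    (hf : ∀ t ∈ Finset.Icc 1 I.T, ∀ i, I.f t i ≤ ENNReal.ofReal (2 * D)) :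
    ∃ i, I.opt = ENNReal.ofReal (∑ t ∈ Finset.range (I.T + 1), I.realCost t i) := by
  obtain ⟨i, hi⟩ := exists_eq_ciInf_of_finite (f := fun i => ∑ t ∈ Finset.Icc 1 I.T, I.f t i)
  refine ⟨i, ?_⟩
  have hsubset : Finset.Icc 1 I.T ⊆ Finset.range (I.T + 1) := fun t ht =>
    Finset.mem_range.2 (Nat.lt_succ_of_le (Finset.mem_Icc.1 ht).2)
  have hsum : ∑ t ∈ Finset.Icc 1 I.T, I.realCost t i =
      ∑ t ∈ Finset.range (I.T + 1), I.realCost t i :=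
    Finset.sum_subset hsubset fun t _ ht => if_neg ht
  rw [Instance.opt, ← hi, ← hsum, ENNReal.ofReal_sum_of_nonneg fun t _ => I.realCost_nonneg t i]
  exact Finset.sum_congr rfl fun t ht => f_eq_ofReal_realCost hf ht i

theorem Instance.expectedCost_le (hR : IsRound R) (hgreedy : IsGreedy I greedy) (hℓ : 2 ≤ ℓ)
    (hm : 2 ≤ m) (hdiam : ∀ a b : M, edist a b ≤ ENNReal.ofReal D) (hD : 0 < D)
    (hf : ∀ t ∈ Finset.Icc 1 I.T, ∀ i, I.f t i ≤ ENNReal.ofReal (2 * D))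
    (hγ0 : 0 < γ) (hγ1 : γ ≤ 1 / 100) (hε0 : 0 < ε) (hγε : γ = (m : ℝ) ^ 2 * ε)
    (hγ : D * ℓ * Real.log ℓ = ε * (γ ^ 2 * I.opt.toReal)) :
    I.expectedCost greedy R D m ε (-Real.log (1 - γ)) ≤
      I.opt + ENNReal.ofReal (25 * (γ * I.opt.toReal)) := by
  have : NeZero ℓ := ⟨by omega⟩
  have hm' : (2 : ℝ) ≤ m := by exact_mod_cast hm
  have hm1 : 1 ≤ m := one_le_two.trans hm
  set η := -Real.log (1 - γ) with hη
  have hexp : Real.exp (-η) = 1 - γ := by rw [hη, neg_neg, Real.exp_log (by linarith)]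
  have hη0 : 0 ≤ η := nonneg_of_exp_neg_eq hexp hγ0.le
  have h2mε : 2 * m * ε ≤ γ := by
    rw [hγε, pow_two]
    gcongr
  have hmε : m * ε ≤ γ := by linarith [mul_nonneg (Nat.cast_nonneg m : (0 : ℝ) ≤ m) hε0.le]
  have hε1 : ε ≤ 1 := by nlinarith
  have hf0 := I.realCost_nonneg
  have hf1 := I.realCost_le hD.le hf
  obtain ⟨i, hi⟩ := I.exists_opt_eq_ofReal hf
  have hopt := Finset.sum_nonneg fun t (_ : t ∈ Finset.range (I.T + 1)) => hf0 t i
  rw [hi, ENNReal.toReal_ofReal hopt] at hγ ⊢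
  rw [← ENNReal.ofReal_add hopt (by positivity)]
  refine (expectedCost_le_ofReal_expect hdiam hD.le hf hgreedy hm hR ε).trans
    (ENNReal.ofReal_le_ofReal ?_)
  simp only [meanStep, expect_sum, expect_add, expect_const_mul, Finset.sum_add_distrib,
    ← Finset.mul_sum]
  refine cost_add_switching_add_backlog_le (by linarith) (by exact_mod_cast NeZero.one_le)
    (one_le_mul_log hℓ) hD hopt hγ0 hγ1 hε0 hγε hγ hη0
    (neg_log_one_sub_le hγ0.le (by linarith))
    (Finset.sum_nonneg fun t _ => expect_nonneg fun β e => meanLoss_nonneg hD.le hf0 t β e) ?_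
    (sum_expect_meanCost_le hD hf0 hf1 hexp hγ0.le hγ1 hε0.le hε1 hm1 hmε)
    (sum_expect_movedMass_le hD.le hf0 hη0)
    (sum_expect_meanBacklog_le hD hf0 hf1 hexp hγ0.le hγ1 hε0.le hε1 h2mε)
  have hregret := sum_expect_meanLoss_le (T := I.T) (m := m) hD.le hf0 hf1 hη0 hε0.le hε1 i
  rwa [hexp, sub_sub_cancel] at hregret

end main

end BanditMTS

end

theorem theorem1_general {M : Type*} [MetricSpace M] [BoundedSpace M] {ℓ m : ℕ}
    {I : BanditMTS.Instance M ℓ} {greedy : ℕ → M → M}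
    {R : (Fin ℓ → ℝ) → (Fin ℓ → ℝ) → Fin ℓ → PMF (Fin ℓ)} {D OPT : ℝ} (hℓ : 2 ≤ ℓ) (hm : 2 ≤ m)
    (hD : D = Metric.diam (Set.univ : Set M)) (hD0 : 0 < D)
    (hf : ∀ t ∈ Finset.Icc 1 I.T, ∀ i, I.f t i ≤ ENNReal.ofReal (2 * D))
    (hOPT : OPT = I.opt.toReal) (hgreedy : BanditMTS.IsGreedy I greedy)
    (hR : BanditMTS.IsRound R) (hlarge : 10 ^ 6 * (D * ℓ * Real.log ℓ * (m : ℝ) ^ 2) ≤ OPT) :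
    (0 < BanditMTS.epsParam D ℓ m OPT ∧ BanditMTS.epsParam D ℓ m OPT < 1) ∧
    (0 < BanditMTS.gammaParam D ℓ m OPT ∧ BanditMTS.gammaParam D ℓ m OPT < 1) ∧
    I.expectedCost greedy R D m (BanditMTS.epsParam D ℓ m OPT)
        (BanditMTS.etaParam D ℓ m OPT) ≤
      I.opt + ENNReal.ofReal (25 * ((D * ℓ * Real.log ℓ) ^ (1 / 3 : ℝ) *
        (m : ℝ) ^ (2 / 3 : ℝ) * OPT ^ (2 / 3 : ℝ))) := by
  have hlog : 0 < Real.log ℓ := Real.log_pos (by exact_mod_cast hℓ)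
  have ha : 0 < D * ℓ * Real.log ℓ := by positivity
  have hO : 0 < OPT := lt_of_lt_of_le (by positivity) hlarge
  have hdiam : ∀ a b : M, edist a b ≤ ENNReal.ofReal D := fun a b => by
    rw [edist_dist, hD]
    exact ENNReal.ofReal_le_ofReal (Metric.dist_le_diam_of_mem
      (Bornology.IsBounded.all _) (Set.mem_univ a) (Set.mem_univ b))
  have hε0 : 0 < BanditMTS.epsParam D ℓ m OPT := by
    unfold BanditMTS.epsParam
    positivity
  have hγε := BanditMTS.gammaParam_eq_sq_mul_epsParam (D := D) (OPT := OPT) (ℓ := ℓ)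
    (show 0 < m by omega)
  have hγ0 : 0 < BanditMTS.gammaParam D ℓ m OPT := by
    rw [hγε]
    positivity
  have hγ1 := BanditMTS.gammaParam_le ha.le hO hlarge
  have hεγ : BanditMTS.epsParam D ℓ m OPT ≤ BanditMTS.gammaParam D ℓ m OPT := by
    rw [hγε]
    exact le_mul_of_one_le_left hε0.le (one_le_pow₀ (by exact_mod_cast one_le_two.trans hm))
  refine ⟨⟨hε0, by linarith⟩, ⟨hγ0, by linarith⟩, ?_⟩
  rw [← BanditMTS.gammaParam_mul_opt hO, BanditMTS.etaParam]
  have hγ := (BanditMTS.epsParam_mul_gammaParam_sq_mul (show 0 < m by omega) ha.le hO).symm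
  subst hOPT
  exact BanditMTS.Instance.expectedCost_le hR hgreedy hℓ hm hdiam hD0 hf hγ0 hγ1 hε0 hγε hγ

theorem theorem1 :
    ∃ C : ℝ, 0 < C ∧ ∀ D₀ : ℝ, 0 < D₀ → ∃ κ : ℝ, 0 < κ ∧
      ∀ (M : Type*) [MetricSpace M] [BoundedSpace M] (ℓ m : ℕ) (I : BanditMTS.Instance M ℓ)
        (greedy : ℕ → M → M) (R : (Fin ℓ → ℝ) → (Fin ℓ → ℝ) → Fin ℓ → PMF (Fin ℓ)) (D OPT : ℝ),
        2 ≤ ℓ → 2 ≤ m →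
        D = Metric.diam (Set.univ : Set M) → D₀ ≤ D →
        (∀ t ∈ Finset.Icc 1 I.T, ∀ i, I.f t i ≤ ENNReal.ofReal (2 * D)) →
        OPT = I.opt.toReal →
        BanditMTS.IsGreedy I greedy →
        BanditMTS.IsRound R →
        D * ℓ * m ≤ κ * OPT ^ (1 / 3 : ℝ) →
        (0 < BanditMTS.epsParam D ℓ m OPT ∧ BanditMTS.epsParam D ℓ m OPT < 1) ∧
        (0 < BanditMTS.gammaParam D ℓ m OPT ∧ BanditMTS.gammaParam D ℓ m OPT < 1) ∧
        I.expectedCost greedy R D m (BanditMTS.epsParam D ℓ m OPT)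
            (BanditMTS.etaParam D ℓ m OPT) ≤
          I.opt + ENNReal.ofReal (C * ((D * ℓ * Real.log ℓ) ^ (1 / 3 : ℝ) *
            (m : ℝ) ^ (2 / 3 : ℝ) * OPT ^ (2 / 3 : ℝ))) := by
  refine ⟨25, by norm_num, fun D₀ hD₀ => ⟨D₀ ^ (2 / 3 : ℝ) / 100, by positivity, ?_⟩⟩
  intro M _ _ ℓ m I greedy R D OPT hℓ hm hD hD₀D hf hOPT hgreedy hR hκ
  exact theorem1_general hℓ hm hD (hD₀.trans_le hD₀D) hf hOPT hgreedy hR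
    (BanditMTS.mul_log_mul_sq_le_of_mul_le_rpow hD₀ hD₀D (hOPT ▸ ENNReal.toReal_nonneg) hκ)
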